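/- Identify $\{0,1\}^n$ with $\mathbb F_2^n$. A counting query is a pair $(S,y)$ with $S\subseteq[n]$ and $y\in\{0,1\}^S$; for a function $\mu:\{0,1\}^n\to\mathbb R_{\ge 0}$ the exact counting oracle answers it by $\sum_{x:\,x_S=y}\mu(x)$. A randomized algorithm with $T$ rounds is a random choice of a deterministic algorithm which in each of $T$ rounds submits a set of counting queries (depending on the answers of the earlier rounds), receives all their answers at once, and after the last round outputs a point of $\{0,1\}^n$. Its computations are not restricted otherwise. Here $\log$ is the natural logarithm. For $n\ge 2$ and $c>0$ put $$\rho=\frac14\Bigl(\frac{n}{(c+2)\log n}\Bigr)^{1/3},\qquad r=\lceil\rho\rceil,\qquad a_i=\Bigl\lfloor 12\,i\,n^{1/3}\bigl((c+2)\log n\bigr)^{2/3}\Bigr\rfloor\quad(1\le i\le r).$$ A block-code instance is given by a partition of $[n]$ into $r$ blocks $S_1,\dots,S_r$, with sizes $m_i=|S_i|\in\{\lfloor n/r\rfloor,\lceil n/r\rceil\}$ and $a_i\le m_i$, and, for each $i$, a matrix $B_i\in\mathbb F_2^{(m_i-a_i)\times m_i}$ with linearly independent rows and a vector $v_i\in\mathbb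 F_2^{m_i-a_i}$. It defines $\mu:\{0,1\}^n\to\{0,1\}$ by $\mu(x)=\prod_{i=1}^r\mathbf 1[B_i x_{S_i}=v_i]$, the indicator function of a nonempty affine subspace of $\mathbb F_2^n$ (its solutions). **Theorem.** For every $\delta\in(0,1]$ there is $n_0=n_0(\delta)$ such that for all $n\ge n_0$, all real $c$ with $0<c<n^{1-\delta}$, all integers $0\le T<\rho$, and every randomized algorithm with $T$ rounds that makes at most $n^c$ counting queries in each round, the following hold. 1. (Search.) There is a block-code instance $\mu$ such that the algorithm, run with the counting oracle of $\mu$, outputs a point $x$ with $\mu(x)=1$ with probability at most $0.01$. 2. (Sampling.) There is a block-code instance such that, for the uniform distribution $p$ on its solutions, the output distribution of the algorithm, run with the counting oracle of $p$ (whose answers are $\mathbb P_{X\sim p}[X_S=y]$), has total variation distance at least $0.99$ from $p$. In particular, an algorithm that makes at most $n^c$ counting queries per round, for a constant $c$, and samples from every distribution on $\{0,1\}^n$ within total variation distance less than $0.99$ needs at least $\rho=\widetilde\Omega(n^{1/3})$ rounds when $n$ is large. -/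

import Mathlib

open MeasureTheory

universe u

/-- The Boolean hypercube `{0,1}^n`, with coordinates in the field `𝔽₂`. -/
abbrev Cube (n : ℕ) : Type := Fin n → ZMod 2

/-- A query `(S, y)` with `S ⊆ [n]` and `y ∈ {0,1}^S`: coordinate `i` is pinned to `b` if the
value is `some b` and is free (that is, `i ∉ S`) if the value is `none`. -/
abbrev Query (n : ℕ) : Type := Fin n → Option (ZMod 2)

/-- The subcube `{x : x_S = y}` of a query. -/
def Query.subcube {n : ℕ} (H : Query n) : Set (Cube n) :=
  {x | ∀ i b, H i = some b → x i = b}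

/-- The exact counting oracle of a weight function `w` on the cube: `H ↦ ∑_{x ∈ H} w x`. If `w` is
a probability mass function, this is the probability that `X_S = y` for `X ∼ w`. -/
noncomputable def countingOracle {n : ℕ} (w : Cube n → ℝ) : Query n → ℝ :=
  fun H => ∑ x : Cube n, H.subcube.indicator w x

/-- Deterministic algorithms with `T` rounds of oracle access. In each round the algorithm submits
a finite set of queries, whose answers it receives simultaneously; how it goes on is an arbitrary
function of these answers (and of the earlier ones). After the last round it outputs a point. -/
inductive RoundAlg (n : ℕ) : ℕ → Type
  | output (x : Cube n) : RoundAlg n 0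
  | round {T : ℕ} (Q : Finset (Query n)) (next : ({H // H ∈ Q} → ℝ) → RoundAlg n T) :
      RoundAlg n (T + 1)

/-- The output of a deterministic algorithm that is run with the oracle `O`. -/
def RoundAlg.run {n : ℕ} (O : Query n → ℝ) : {T : ℕ} → RoundAlg n T → Cube n
  | _, .output x => x
  | _, .round _ next => (next fun H => O H.1).run O

/-- In each round the algorithm submits at most `k` queries. -/
def RoundAlg.QueriesAtMost {n : ℕ} (k : ℝ) : {T : ℕ} → RoundAlg n T → Prop
  | _, .output _ => True
  | _, .round Q next => (Q.card : ℝ) ≤ k ∧ ∀ ans, (next ans).QueriesAtMost k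

/-- Randomized algorithms with `T` rounds: deterministic algorithms that depend on a random seed
from an arbitrary probability space, such that for each oracle the output is a random variable. -/
structure RandAlg (n T : ℕ) where
  Seed : Type u
  [measurableSpace : MeasurableSpace Seed]
  prob : Measure Seed
  [isProbabilityMeasure : IsProbabilityMeasure prob]
  alg : Seed → RoundAlg n T
  measurableSet_run : ∀ (O : Query n → ℝ) (x : Cube n),
    MeasurableSet {ω | (alg ω).run O = x}

/-- In each round, and for each seed, the algorithm submits at most `k` queries. -/
def RandAlg.QueriesAtMost {n T : ℕ} (A : RandAlg.{u} n T) (k : ℝ) : Prop :=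
  ∀ ω, (A.alg ω).QueriesAtMost k

/-- The probability that the output of `A`, run with the oracle `O`, lies in `s`. -/
noncomputable def RandAlg.outputProb {n T : ℕ} (A : RandAlg.{u} n T) (O : Query n → ℝ)
    (s : Set (Cube n)) : ℝ :=
  letI := A.measurableSpace
  A.prob.real {ω | (A.alg ω).run O ∈ s}

/-- The total variation distance of two probability mass functions on the cube. -/
noncomputable def tvDist {n : ℕ} (p q : Cube n → ℝ) : ℝ :=
  (1 / 2) * ∑ x : Cube n, |p x - q x|

/-- An instance made of linear codes on blocks: a partition of the `n` coordinates into `r` blocks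
of size `⌊n / r⌋` or `⌈n / r⌉`, and on the `i`-th block, of size `mᵢ`, a system `Bᵢ x = vᵢ` of
`mᵢ - aᵢ` linearly independent equations over `𝔽₂` (so `aᵢ ≤ mᵢ`). -/
structure BlockCode (n r : ℕ) (a : Fin r → ℕ) where
  block : Fin n → Fin r
  card_block : ∀ i, Fintype.card {j // block j = i} = n / r ∨
    Fintype.card {j // block j = i} = n / r + 1
  rows : Fin r → ℕ
  rows_add : ∀ i, rows i + a i = Fintype.card {j // block j = i}
  B : ∀ i, Matrix (Fin (rows i)) {j // block j = i} (ZMod 2)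
  v : ∀ i, Fin (rows i) → ZMod 2
  linearIndependent_rows : ∀ i, LinearIndependent (ZMod 2) (B i).row

namespace BlockCode

variable {n r : ℕ} {a : Fin r → ℕ} (I : BlockCode n r a)

/-- The solutions: the points whose restriction to each block satisfies the block's equations. -/
def support : Set (Cube n) :=
  {x | ∀ i, (I.B i).mulVec (fun j => x j.1) = I.v i}

/-- The instance as a function `μ : {0,1}^n → {0,1}`. -/
noncomputable def mu : Cube n → ℝ := I.support.indicator 1

/-- The instance as a probability mass function: the uniform distribution on the solutions. -/
noncomputable def uniform : Cube n → ℝ := fun x => I.mu x / ∑ y : Cube n, I.mu y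

end BlockCode

/-- The bound `(1/4) (n / ((c + 2) log n))^(1/3)` on the number of rounds. -/
noncomputable def roundBound (n : ℕ) (c : ℝ) : ℝ :=
  (1 / 4) * ((n : ℝ) / ((c + 2) * Real.log n)) ^ (1 / 3 : ℝ)

/-- The number of blocks of the hard instances: `roundBound n c`, rounded up. -/
noncomputable def numBlocks (n : ℕ) (c : ℝ) : ℕ := ⌈roundBound n c⌉₊

/-- The dimension of the code on the `i`-th block (blocks are numbered from `1` in the formula):
`i * 12 * n^(1/3) * ((c + 2) log n)^(2/3)`, rounded down. -/
noncomputable def codeDim (n : ℕ) (c : ℝ) (i : Fin (numBlocks n c)) : ℕ :=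
  ⌊((i : ℕ) + 1 : ℝ) * (12 * (n : ℝ) ^ (1 / 3 : ℝ) * ((c + 2) * Real.log n) ^ (2 / 3 : ℝ))⌋₊

/-! The hard instance is random: a random assignment of coordinates to blocks, and on each block
uniformly random equations. With `L = (c + 2) log n` and `x = (n / L)^(1/3)` there are about `x / 4`
blocks, and the number `R i` of equations drops by about `12 L x` from one block to the next.

The algorithm learns essentially one block per round. Suppose it knows nothing of blocks `t, t+1, …`
(numbered from 0) and asks a query with free set `F`. If block `t` has no point in the subcube, the
count is zero and later blocks do not matter. If the equations of every later block `j` keep full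
rank on its free coordinates, each later block divides the count by exactly `2 ^ R j`. So the answer
can be computed from blocks `0, …, t` alone, unless some `j > t` is `Exposed`
(`exists_exposed_of_simOracle_ne`).

Exposure is unlikely. Randomness of `v t` bounds it by `2^(|S t ∩ F| - R t)`, randomness of `B j` by
`2^(R j - |S j ∩ F|)`. Since `R t` exceeds `R j` by a wide margin, one of the two is tiny unless `F`
meets `S t` in far more points than `S j`. Random blocks prevent this: the difference has a
sub-Gaussian exponential moment (`sum_mul_exposed_le`, `sum_perm_mul_exp_le`). Adaptivity is
harmless because the round-`t` queries against the simulated oracle depend on blocks before `t` only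
(`sum_exposed_le`).

After a union bound over queries and pairs of blocks, the real run equals the simulated one with
high probability. The simulated output is independent of `v i` for every `i ≥ T`, so it solves block
`i` with probability at most `2 ^ (-R i)` (`sum_runWith_last_le`). Averaging fixes one good
instance. A rescaled oracle changes nothing, which gives sampling as well as search. -/

open Finset

/-! ### Runs against an oracle that changes from round to round -/

namespace RoundAlg

/-- The output of an algorithm whose queries in round `t` are answered by `O t`. -/
def runWith {n : ℕ} : {T : ℕ} → (ℕ → Query n → ℝ) → RoundAlg n T → Cube n
  | _, _, .output x => x
  | _, O, .round _ next => runWith (fun t => O (t + 1)) (next fun H => O 0 H.1)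

/-- The queries of round `t` of an algorithm that is run with the oracles `O 0, O 1, …`. -/
def queriesWith {n : ℕ} : {T : ℕ} → (ℕ → Query n → ℝ) → RoundAlg n T → ℕ → Finset (Query n)
  | _, _, .output _, _ => ∅
  | _, _, .round Q _, 0 => Q
  | _, O, .round _ next, t + 1 =>
      queriesWith (fun t => O (t + 1)) (next fun H => O 0 H.1) t

theorem runWith_congr {n T : ℕ} (A : RoundAlg n T) :
    ∀ {O O' : ℕ → Query n → ℝ}, (∀ s < T, O s = O' s) → A.runWith O = A.runWith O' := by
  induction A with
  | output x => intros; rfl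
  | round Q next ih =>
    intro O O' h
    simp only [runWith, h 0 (Nat.succ_pos _)]
    exact ih _ fun s hs => h (s + 1) (Nat.succ_lt_succ hs)

theorem queriesWith_congr {n T : ℕ} (A : RoundAlg n T) :
    ∀ {O O' : ℕ → Query n → ℝ} (t : ℕ), (∀ s < t, O s = O' s) →
      A.queriesWith O t = A.queriesWith O' t := by
  induction A with
  | output x => intros; rfl
  | round Q next ih =>
    intro O O' t h
    cases t with
    | zero => rfl
    | succ t =>
      simp only [queriesWith, h 0 (Nat.succ_pos _)]
      exact ih _ t fun s hs => h (s + 1) (Nat.succ_lt_succ hs)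

theorem card_queriesWith_le {n T : ℕ} {k : ℝ} (hk : 0 ≤ k) (A : RoundAlg n T) :
    A.QueriesAtMost k → ∀ (O : ℕ → Query n → ℝ) (t : ℕ), ((A.queriesWith O t).card : ℝ) ≤ k := by
  induction A with
  | output x => intro _ O t; simpa [queriesWith] using hk
  | round Q next ih =>
    intro h O t
    cases t with
    | zero => exact h.1
    | succ t => exact ih _ (h.2 _) _ t

/-- Agreement is needed only on the queries of the simulated run, whose distribution can be
controlled; nothing is assumed about the queries of the real run. -/
theorem run_eq_runWith {n T : ℕ} (A : RoundAlg n T) (F : Query n → ℝ) :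
    ∀ {O : ℕ → Query n → ℝ}, (∀ t < T, ∀ H ∈ A.queriesWith O t, O t H = F H) →
      A.run F = A.runWith O := by
  induction A with
  | output x => intros; rfl
  | round Q next ih =>
    intro O h
    have h0 : (fun H : {H // H ∈ Q} => F H.1) = fun H => O 0 H.1 :=
      funext fun H => (h 0 (Nat.succ_pos _) H.1 H.2).symm
    simp only [run, runWith, h0]
    exact ih _ fun t ht H hH => h (t + 1) (Nat.succ_lt_succ ht) H hH

end RoundAlg

/-! ### Averaging lemmas -/


/-- Exchanging `v t` with the fresh value `a` is an involution on pairs, so resampling one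
coordinate preserves the uniform measure. -/
theorem sum_update_eq {ι : Type*} [DecidableEq ι] [Fintype ι] {α : ι → Type*} [∀ i, Fintype (α i)]
    [∀ i, DecidableEq (α i)] (t : ι) (f : (∀ i, α i) → ℝ) :
    ∑ v, ∑ a, f (Function.update v t a) = Fintype.card (α t) * ∑ v, f v := by
  let e : ((∀ i, α i) × α t) ≃ ((∀ i, α i) × α t) :=
    Function.Involutive.toPerm (fun p => (Function.update p.1 t p.2, p.1 t))
      (fun p => by simp)
  calc ∑ v, ∑ a, f (Function.update v t a)
      = ∑ p : (∀ i, α i) × α t, f (e p).1 := by rw [Fintype.sum_prod_type]; rfl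
    _ = ∑ p : (∀ i, α i) × α t, f p.1 := Equiv.sum_comp e fun p => f p.1
    _ = _ := by rw [Fintype.sum_prod_type]; simp [mul_sum]

theorem card_mul_sum_mul_ite_mem {ι : Type*} [DecidableEq ι] [Fintype ι] {α : ι → Type*}
    [∀ i, Fintype (α i)] [∀ i, DecidableEq (α i)] (t : ι) (s : Finset (α t))
    (g : (∀ i, α i) → ℝ) (hg : ∀ v a, g (Function.update v t a) = g v) :
    Fintype.card (α t) * ∑ v, g v * (if v t ∈ s then 1 else 0) = #s * ∑ v, g v := by
  rw [← sum_update_eq t, mul_sum]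
  refine sum_congr rfl fun v _ => ?_
  simp [hg, mul_comm]

/-- Symmetrization: `τ l` preserves the weight, flips the sign of `d l` and fixes the other `d l'`.
Averaging the sum with its reflection replaces one exponential factor by `cosh (lam * d l)`, which
is at most `cosh lam`. -/
theorem sum_mul_exp_le {Ω ι : Type*} [Fintype Ω] [DecidableEq ι] (lam : ℝ) (τ : ι → Equiv.Perm Ω)
    (d : ι → Ω → ℝ) (hd : ∀ l ω, |d l ω| ≤ 1) (hself : ∀ l ω, d l (τ l ω) = -d l ω)
    (hne : ∀ l l' ω, l' ≠ l → d l' (τ l ω) = d l' ω) (g : Ω → ℝ) (hg0 : ∀ ω, 0 ≤ g ω)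
    (hg : ∀ l ω, g (τ l ω) = g ω) (P : Finset ι) :
    ∑ ω, g ω * Real.exp (lam * ∑ l ∈ P, d l ω) ≤ Real.cosh lam ^ #P * ∑ ω, g ω := by
  induction P using Finset.induction_on with
  | empty => simp
  | insert l P hl ih =>
    have h1 : ∑ ω, g ω * Real.exp (lam * ∑ l ∈ insert l P, d l ω) =
        ∑ ω, g ω * Real.exp (lam * ∑ l ∈ P, d l ω) * Real.exp (lam * d l ω) :=
      sum_congr rfl fun ω _ => by
        rw [sum_insert hl, mul_add, Real.exp_add]; ring
    have h2 : ∑ ω, g ω * Real.exp (lam * ∑ l ∈ P, d l ω) * Real.exp (lam * d l ω) =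
        ∑ ω, g ω * Real.exp (lam * ∑ l ∈ P, d l ω) * Real.exp (-(lam * d l ω)) := by
      rw [← Equiv.sum_comp (τ l)]
      refine sum_congr rfl fun ω _ => ?_
      rw [hg, hself, sum_congr rfl fun l' hl' => hne l l' ω fun h => hl (h ▸ hl')]
      ring_nf
    have h3 : ∑ ω, g ω * Real.exp (lam * ∑ l ∈ insert l P, d l ω) =
        ∑ ω, g ω * Real.exp (lam * ∑ l ∈ P, d l ω) * Real.cosh (lam * d l ω) := by
      have : ∀ ω, g ω * Real.exp (lam * ∑ l ∈ P, d l ω) * Real.cosh (lam * d l ω) =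
          (g ω * Real.exp (lam * ∑ l ∈ P, d l ω) * Real.exp (lam * d l ω) +
          g ω * Real.exp (lam * ∑ l ∈ P, d l ω) * Real.exp (-(lam * d l ω))) / 2 := by
        intro ω; rw [Real.cosh_eq]; ring
      simp_rw [this]
      rw [← sum_div, sum_add_distrib, ← h2, h1]; ring
    rw [h3, card_insert_of_notMem hl, pow_succ', mul_assoc]
    refine le_trans ?_ (mul_le_mul_of_nonneg_left ih (Real.cosh_pos _).le)
    rw [mul_sum]
    refine sum_le_sum fun ω _ => ?_
    rw [mul_comm]
    refine mul_le_mul_of_nonneg_right ?_ (mul_nonneg (hg0 ω) (Real.exp_pos _).le)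
    rw [Real.cosh_le_cosh, abs_mul]
    exact mul_le_of_le_one_right (abs_nonneg _) (hd l ω)

/-! ### Linear systems over `𝔽₂` -/

/-- The product of a matrix with a vector, restricted to the columns in `S`. -/
def mulOn {n R : ℕ} (S : Finset (Fin n)) (M : Matrix (Fin R) (Fin n) (ZMod 2)) (x : Cube n) :
    Fin R → ZMod 2 :=
  fun l => ∑ j ∈ S, M l j * x j

/-- The rows of `M`, restricted to the columns in `C`, are linearly independent. -/
def FullOn {n R : ℕ} (M : Matrix (Fin R) (Fin n) (ZMod 2)) (C : Finset (Fin n)) : Prop :=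
  ∀ u : Fin R → ZMod 2, (∀ j ∈ C, ∑ l, u l * M l j = 0) → u = 0

theorem mulOn_add {n R : ℕ} (S : Finset (Fin n)) (M : Matrix (Fin R) (Fin n) (ZMod 2))
    (x y : Cube n) : mulOn S M (x + y) = mulOn S M x + mulOn S M y := by
  ext l; simp [mulOn, mul_add, sum_add_distrib]

theorem FullOn.exists_mulOn_eq {n R : ℕ} {M : Matrix (Fin R) (Fin n) (ZMod 2)}
    {C S : Finset (Fin n)} (h : FullOn M C) (hCS : C ⊆ S) (v : Fin R → ZMod 2) :
    ∃ z : Cube n, (∀ j ∉ C, z j = 0) ∧ mulOn S M z = v := by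
  let N : Matrix (Fin R) C (ZMod 2) := fun l j => M l j
  have hsurj : Function.Surjective N.mulVec := by
    have hli : LinearIndependent (ZMod 2) N.row := by
      rw [Fintype.linearIndependent_iff]
      intro u hu l
      refine congrFun (h u fun j hj => ?_) l
      simpa [N, Matrix.row] using congrFun hu ⟨j, hj⟩
    have htop : LinearMap.range N.mulVecLin = ⊤ := by
      apply Submodule.eq_top_of_finrank_eq
      rw [← Matrix.rank, hli.rank_matrix, Module.finrank_fintype_fun_eq_card]
    exact LinearMap.range_eq_top.1 htop
  obtain ⟨w, hw⟩ := hsurj v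
  refine ⟨fun j => if hj : j ∈ C then w ⟨j, hj⟩ else 0, fun j hj => by simp [hj], ?_⟩
  rw [← hw]
  ext l
  simp only [mulOn, Matrix.mulVec, dotProduct, N]
  rw [← sum_subset hCS fun j _ hj => by simp [hj], ← sum_attach]
  exact sum_congr rfl fun j _ => by simp

/-- Full rank on `C` makes every difference of right-hand sides the image of a vector supported on
`C`. Translation by it maps one fibre in `X` onto another, so all `2 ^ R` fibres have equal size. -/
theorem card_filter_mulOn_eq {n R : ℕ} {M : Matrix (Fin R) (Fin n) (ZMod 2)}
    {C S : Finset (Fin n)} (h : FullOn M C) (hCS : C ⊆ S) (v : Fin R → ZMod 2)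
    (X : Finset (Cube n)) (hX : ∀ x ∈ X, ∀ z : Cube n, (∀ j ∉ C, z j = 0) → x + z ∈ X) :
    #{x ∈ X | mulOn S M x = v} * 2 ^ R = #X := by
  have hfib : ∀ w, #{x ∈ X | mulOn S M x = w} = #{x ∈ X | mulOn S M x = v} := by
    intro w
    obtain ⟨z, hz, hzw⟩ := h.exists_mulOn_eq hCS (v - w)
    refine card_bij' (fun x _ => x + z) (fun x _ => x + -z) ?_ ?_ ?_ ?_
    · intro x hx
      simp only [mem_filter] at hx ⊢
      exact ⟨hX x hx.1 z hz, by rw [mulOn_add, hx.2, hzw]; abel⟩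
    · intro x hx
      simp only [mem_filter] at hx ⊢
      refine ⟨hX x hx.1 _ fun j hj => by simp [hz j hj], ?_⟩
      have := mulOn_add S M (x + -z) z
      rw [neg_add_cancel_right, hx.2, hzw] at this
      rw [← sub_eq_iff_eq_add] at this
      rw [← this]; abel
    · intros; simp
    · intros; simp
  have := card_eq_sum_card_fiberwise (f := mulOn S M) (s := X) (t := univ) (fun _ _ => by simp)
  simpa [hfib, mul_comm] using this.symm

/-- The additive map from `M` to the combination of its rows on `C` is onto, since a single row with
nonzero coefficient reaches every value; hence its fibres have equal size. -/
theorem card_vecMul_eq_zero_mul {n R : ℕ} (C : Finset (Fin n)) {u : Fin R → ZMod 2}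
    (hu : u ≠ 0) :
    #{M : Matrix (Fin R) (Fin n) (ZMod 2) | ∀ j ∈ C, ∑ l, u l * M l j = 0} * 2 ^ #C =
      Fintype.card (Matrix (Fin R) (Fin n) (ZMod 2)) := by
  classical
  let f : Matrix (Fin R) (Fin n) (ZMod 2) →+ (C → ZMod 2) :=
    { toFun := fun M j => ∑ l, u l * M l j
      map_zero' := by ext; simp
      map_add' := fun M N => by ext; simp [mul_add, sum_add_distrib] }
  have hf : Function.Surjective f := by
    intro w
    obtain ⟨l₀, hl₀⟩ := Function.ne_iff.1 hu
    refine ⟨fun l j => if l = l₀ then (if hj : j ∈ C then (u l₀)⁻¹ * w ⟨j, hj⟩ else 0) else 0, ?_⟩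
    ext j
    simp only [Pi.zero_apply] at hl₀
    simp [f, hl₀]
  have h0 : ({M | ∀ j ∈ C, ∑ l, u l * M l j = 0} : Finset (Matrix (Fin R) (Fin n) (ZMod 2))) =
      ({M | f M = 0} : Finset _) := by
    ext M; simp [f, funext_iff]
  have := card_eq_sum_card_fiberwise (f := f) (s := univ) (t := univ) (fun _ _ => by simp)
  rw [sum_congr rfl fun w _ =>
    AddMonoidHom.card_fiber_eq_of_mem_range f (x := w) (y := 0) (hf w) (hf 0)] at this
  rw [h0, ← card_univ, this]
  simp [mul_comm]

open Classical in
-- Union bound over the nonzero vectors `u` that could witness a dependency.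
theorem card_not_fullOn_mul_le {n R : ℕ} (C : Finset (Fin n)) :
    #{M : Matrix (Fin R) (Fin n) (ZMod 2) | ¬ FullOn M C} * 2 ^ #C ≤
      2 ^ R * Fintype.card (Matrix (Fin R) (Fin n) (ZMod 2)) := by
  have hsub : ({M | ¬ FullOn M C} : Finset (Matrix (Fin R) (Fin n) (ZMod 2))) ⊆
      (univ.filter fun u : Fin R → ZMod 2 => u ≠ 0).biUnion
        fun u => {M | ∀ j ∈ C, ∑ l, u l * M l j = 0} := by
    intro M hM
    simp only [FullOn, mem_filter, mem_univ, true_and, not_forall] at hM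
    obtain ⟨u, hu, hu0⟩ := hM
    simp only [mem_biUnion, mem_filter, mem_univ, true_and]
    exact ⟨u, hu0, hu⟩
  calc _ ≤ (∑ u : Fin R → ZMod 2 with u ≠ 0,
        #{M : Matrix (Fin R) (Fin n) (ZMod 2) | ∀ j ∈ C, ∑ l, u l * M l j = 0}) * 2 ^ #C :=
        Nat.mul_le_mul_right _ ((card_le_card hsub).trans card_biUnion_le)
    _ = ∑ u : Fin R → ZMod 2 with u ≠ 0, Fintype.card (Matrix (Fin R) (Fin n) (ZMod 2)) := by
        rw [sum_mul]
        exact sum_congr rfl fun u hu => by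
          convert card_vecMul_eq_zero_mul C (mem_filter.1 hu).2
    _ ≤ _ := by
        rw [sum_const, smul_eq_mul]
        refine Nat.mul_le_mul_right _ ((card_le_univ _).trans ?_)
        simp

theorem card_image_mulOn_le {n R : ℕ} (S P : Finset (Fin n)) (y : Cube n)
    (M : Matrix (Fin R) (Fin n) (ZMod 2)) (X : Finset (Cube n))
    (hX : ∀ x ∈ X, ∀ j ∈ S \ P, x j = y j) : #(X.image (mulOn S M)) ≤ 2 ^ #(S ∩ P) := by
  classical
  have hsub : X.image (mulOn S M) ⊆ (univ : Finset (↥(S ∩ P) → ZMod 2)).image fun w =>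
      mulOn S M fun j => if hj : j ∈ S ∩ P then w ⟨j, hj⟩ else y j := by
    intro v hv
    obtain ⟨x, hx, rfl⟩ := mem_image.1 hv
    refine mem_image.2 ⟨fun j => x j, mem_univ _, ?_⟩
    ext l
    refine sum_congr rfl fun j hj => ?_
    dsimp only
    split_ifs with h
    · rfl
    · rw [hX x hx j (by simp_all)]
  refine (card_le_card hsub).trans (card_image_le.trans ?_)
  simp only [card_univ, Fintype.card_fun, ZMod.card, Fintype.card_coe]
  exact le_rfl

/-! ### Systems of equations on disjoint blocks -/

/-- The coordinates that a query leaves free. -/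
def Query.free {n : ℕ} (H : Query n) : Finset (Fin n) := {j | H j = none}

theorem Query.mem_subcube_iff_of_eqOn {n : ℕ} (H : Query n) {x y : Cube n}
    (h : ∀ j ∉ H.free, x j = y j) : x ∈ H.subcube ↔ y ∈ H.subcube := by
  have key : ∀ i b, H i = some b → x i = y i := fun i b hb => h i (by simp [Query.free, hb])
  constructor <;> intro hx i b hb
  · rw [← key i b hb]; exact hx i b hb
  · rw [key i b hb]; exact hx i b hb

theorem Query.eqOn_of_mem_subcube {n : ℕ} (H : Query n) {x y : Cube n} (hx : x ∈ H.subcube)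
    (hy : y ∈ H.subcube) {j : Fin n} (hj : j ∉ H.free) : x j = y j := by
  obtain ⟨b, hb⟩ := Option.ne_none_iff_exists'.1 (show H j ≠ none by simpa [Query.free] using hj)
  rw [hx j b hb, hy j b hb]

section sols

variable {n r : ℕ} {R : Fin r → ℕ}

open Classical in
/-- The points of a subcube that satisfy the equations of the blocks in `I`. -/
noncomputable def sols (S : Fin r → Finset (Fin n))
    (B : ∀ i, Matrix (Fin (R i)) (Fin n) (ZMod 2)) (v : ∀ i, Fin (R i) → ZMod 2)
    (I : Finset (Fin r)) (H : Query n) : Finset (Cube n) :=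
  {x | x ∈ H.subcube ∧ ∀ i ∈ I, mulOn (S i) (B i) x = v i}

theorem mem_sols {S : Fin r → Finset (Fin n)} {B : ∀ i, Matrix (Fin (R i)) (Fin n) (ZMod 2)}
    {v : ∀ i, Fin (R i) → ZMod 2} {I : Finset (Fin r)} {H : Query n} {x : Cube n} :
    x ∈ sols S B v I H ↔ x ∈ H.subcube ∧ ∀ i ∈ I, mulOn (S i) (B i) x = v i := by
  simp [sols]

theorem sols_congr {S S' : Fin r → Finset (Fin n)}
    {B B' : ∀ i, Matrix (Fin (R i)) (Fin n) (ZMod 2)} {v v' : ∀ i, Fin (R i) → ZMod 2}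
    {I : Finset (Fin r)} (hS : ∀ i ∈ I, S i = S' i) (hB : ∀ i ∈ I, B i = B' i)
    (hv : ∀ i ∈ I, v i = v' i) (H : Query n) : sols S B v I H = sols S' B' v' I H := by
  ext x
  simp only [mem_sols]
  refine and_congr_right fun _ => forall₂_congr fun i hi => ?_
  rw [hS i hi, hB i hi, hv i hi]

/-- Blocks of `J` are added one at a time. Moving free coordinates inside `S j` affects neither the
subcube nor the other, disjoint blocks, so the fibres of block `j` are equidistributed. -/
theorem card_sols_union {S : Fin r → Finset (Fin n)} (hS : ∀ i j, i ≠ j → Disjoint (S i) (S j))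
    (B : ∀ i, Matrix (Fin (R i)) (Fin n) (ZMod 2)) (v : ∀ i, Fin (R i) → ZMod 2) (H : Query n)
    (I J : Finset (Fin r)) (hIJ : Disjoint I J)
    (hJ : ∀ j ∈ J, FullOn (B j) (S j ∩ H.free)) :
    #(sols S B v (I ∪ J) H) * 2 ^ ∑ j ∈ J, R j = #(sols S B v I H) := by
  induction J using Finset.induction_on with
  | empty => simp
  | insert j J hj ih =>
    rw [disjoint_insert_right] at hIJ
    have hX : sols S B v (I ∪ insert j J) H =
        {x ∈ sols S B v (I ∪ J) H | mulOn (S j) (B j) x = v j} := by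
      ext x
      simp only [mem_sols, mem_filter, union_insert, mem_insert, forall_eq_or_imp]
      tauto
    have hclosed : ∀ x ∈ sols S B v (I ∪ J) H, ∀ z : Cube n,
        (∀ k ∉ S j ∩ H.free, z k = 0) → x + z ∈ sols S B v (I ∪ J) H := by
      intro x hx z hz
      rw [mem_sols] at hx ⊢
      refine ⟨(H.mem_subcube_iff_of_eqOn fun k hk => ?_).1 hx.1, fun i hi => ?_⟩
      · simp [hz k fun h => hk (mem_inter.1 h).2]
      · have hij : i ≠ j := by
          rintro rfl
          exact (mem_union.1 hi).elim hIJ.1 hj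
        have h0 : mulOn (S i) (B i) z = 0 := by
          ext l
          refine sum_eq_zero fun k hk => ?_
          rw [hz k fun h => disjoint_left.1 (hS i j hij) hk (mem_inter.1 h).1, mul_zero]
        rw [mulOn_add, h0, add_zero, hx.2 i hi]
    rw [sum_insert hj, pow_add, ← mul_assoc, hX,
      card_filter_mulOn_eq (hJ j (mem_insert_self _ _)) inter_subset_left (v j) _ hclosed,
      ih hIJ.2 fun i hi => hJ i (mem_insert_of_mem hi)]

/-- The oracle that knows the blocks up to the `t`-th and takes the others to be generic. -/
noncomputable def simOracle (κ : ℝ) (S : Fin r → Finset (Fin n))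
    (B : ∀ i, Matrix (Fin (R i)) (Fin n) (ZMod 2)) (v : ∀ i, Fin (R i) → ZMod 2) (t : ℕ)
    (H : Query n) : ℝ :=
  κ * (#(sols S B v {i | i.val ≤ t} H) / 2 ^ ∑ j : Fin r with ¬ j.val ≤ t, R j)

theorem simOracle_congr (κ : ℝ) {S S' : Fin r → Finset (Fin n)}
    {B B' : ∀ i, Matrix (Fin (R i)) (Fin n) (ZMod 2)} {v v' : ∀ i, Fin (R i) → ZMod 2} {t : ℕ}
    (hS : ∀ i : Fin r, i.val ≤ t → S i = S' i) (hB : ∀ i : Fin r, i.val ≤ t → B i = B' i)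
    (hv : ∀ i : Fin r, i.val ≤ t → v i = v' i) :
    simOracle κ S B v t = simOracle κ S' B' v' t := by
  ext H
  rw [simOracle, simOracle, sols_congr (S' := S') (B' := B') (v' := v')] <;> simpa

/-- Block `t` admits a point of the query, and block `j` does not behave generically on it. -/
def Exposed (S : Fin r → Finset (Fin n)) (B : ∀ i, Matrix (Fin (R i)) (Fin n) (ZMod 2))
    (v : ∀ i, Fin (R i) → ZMod 2) (t j : Fin r) (H : Query n) : Prop :=
  (∃ x ∈ H.subcube, mulOn (S t) (B t) x = v t) ∧ ¬ FullOn (B j) (S j ∩ H.free)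

theorem exists_exposed_of_simOracle_ne (κ : ℝ) {S : Fin r → Finset (Fin n)}
    (hS : ∀ i j, i ≠ j → Disjoint (S i) (S j))
    {B : ∀ i, Matrix (Fin (R i)) (Fin n) (ZMod 2)} {v : ∀ i, Fin (R i) → ZMod 2} {t : Fin r}
    {H : Query n} (h : simOracle κ S B v t H ≠ κ * #(sols S B v univ H)) :
    ∃ j, t < j ∧ Exposed S B v t j H := by
  by_contra! hcon
  apply h
  by_cases hx : ∃ x ∈ H.subcube, mulOn (S t) (B t) x = v t
  · have hfull : ∀ j ∈ ({j | ¬ j.val ≤ t.val} : Finset (Fin r)),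
        FullOn (B j) (S j ∩ H.free) := by
      intro j hj
      by_contra hn
      exact hcon j (by simpa using hj) ⟨hx, hn⟩
    have := card_sols_union hS B v H {i | i.val ≤ t.val} _
      (disjoint_filter_filter_not _ _ _) hfull
    rw [filter_union_filter_not_eq] at this
    rw [simOracle, ← this]
    push_cast
    rw [mul_div_cancel_right₀ _ (by positivity)]
  · have hempty : ∀ I : Finset (Fin r), t ∈ I → sols S B v I H = ∅ := by
      intro I hI
      refine eq_empty_of_forall_notMem fun x hxs => hx ?_
      rw [mem_sols] at hxs
      exact ⟨x, hxs.1, hxs.2 t hI⟩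
    rw [simOracle, hempty _ (by simp), hempty _ (mem_univ t)]
    simp

open Classical in
-- The weight `g` stands for the event that `H` is asked, which ignores `v t` and `B j`. Bounding by
-- an exponential of the full exponent, rather than by the smaller probability, prepares the average
-- over partitions.
theorem sum_mul_exposed_le (S : Fin r → Finset (Fin n)) (t j : Fin r) (H : Query n)
    (g : (∀ i, Matrix (Fin (R i)) (Fin n) (ZMod 2)) → (∀ i, Fin (R i) → ZMod 2) → ℝ)
    (hg0 : ∀ B v, 0 ≤ g B v) (hgv : ∀ B v a, g B (Function.update v t a) = g B v)
    (hgB : ∀ B v M, g (Function.update B j M) v = g B v) {lam : ℝ} (hlam0 : 0 ≤ lam)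
    (hlam : lam ≤ Real.log 2 / 2) :
    ∑ B, ∑ v, g B v * (if Exposed S B v t j H then 1 else 0) ≤
      Real.exp (lam * (((#(S t ∩ H.free) : ℝ) - #(S j ∩ H.free)) - (R t - R j))) *
        ∑ B, ∑ v, g B v := by
  set D : ℝ := ((#(S t ∩ H.free) : ℝ) - #(S j ∩ H.free)) - (R t - R j) with hD
  have hexp : ∀ k : ℕ, (2 : ℝ) ^ k = Real.exp (Real.log 2 * k) := by
    intro k
    rw [← Real.rpow_natCast, Real.rpow_def_of_pos two_pos]
  -- For negative `D`, `log 2 * (D / 2) ≤ lam * D` is exactly what `lam ≤ log 2 / 2` provides.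
  have hpow : ∀ a b : ℕ, D < 0 → (a : ℝ) - b ≤ D / 2 →
      (2 : ℝ) ^ a ≤ 2 ^ b * Real.exp (lam * D) := by
    intro a b hD0 hab
    rw [hexp, hexp, ← Real.exp_add, Real.exp_le_exp]
    have := Real.log_pos one_lt_two
    nlinarith
  have hnn : ∀ (p : Prop) [Decidable p], (0 : ℝ) ≤ if p then 1 else 0 := by
    intro p _; split_ifs <;> norm_num
  have hind : ∀ {p q : Prop} [Decidable p] [Decidable q], (p → q) →
      (if p then (1 : ℝ) else 0) ≤ if q then 1 else 0 := by
    intro p q _ _ hpq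
    by_cases hp : p
    · simp [hp, hpq hp]
    · simpa [hp] using hnn q
  rcases le_or_gt 0 D with hD0 | hD0
  · calc _ ≤ ∑ B, ∑ v, g B v := sum_le_sum fun B _ => sum_le_sum fun v _ =>
          mul_le_of_le_one_right (hg0 B v) (by split_ifs <;> norm_num)
      _ ≤ _ := le_mul_of_one_le_left (sum_nonneg fun B _ => sum_nonneg fun v _ => hg0 B v)
          (Real.one_le_exp (mul_nonneg hlam0 hD0))
  · have hsplit : (#(S t ∩ H.free) : ℝ) - R t ≤ D / 2 ∨ (R j : ℝ) - #(S j ∩ H.free) ≤ D / 2 := by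
      by_contra! h
      linarith [h.1, h.2]
    rcases hsplit with h | h
    · rw [mul_sum]
      refine sum_le_sum fun B _ => ?_
      let A : Finset (Fin (R t) → ZMod 2) := image (mulOn (S t) (B t)) {x | x ∈ H.subcube}
      have hA : (#A : ℝ) ≤ 2 ^ #(S t ∩ H.free) := by
        rcases Set.eq_empty_or_nonempty H.subcube with he | ⟨y, hy⟩
        · simp [A, he]
        · exact_mod_cast card_image_mulOn_le (S t) H.free y (B t) _ fun x hx j hj =>
            H.eqOn_of_mem_subcube (by simpa using hx) hy (mem_sdiff.1 hj).2
      have hmain := card_mul_sum_mul_ite_mem t A (g B) (hgv B)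
      have hcard : (Fintype.card (Fin (R t) → ZMod 2) : ℝ) = 2 ^ R t := by simp
      rw [hcard] at hmain
      have hle : ∑ v, g B v * (if Exposed S B v t j H then 1 else 0) ≤
          ∑ v, g B v * (if v t ∈ A then 1 else 0) :=
        sum_le_sum fun v _ => mul_le_mul_of_nonneg_left (hind fun hE => by
          obtain ⟨⟨x, hx, hxv⟩, -⟩ := hE
          exact mem_image.2 ⟨x, by simpa using hx, hxv⟩) (hg0 B v)
      have hG : 0 ≤ ∑ v, g B v := sum_nonneg fun v _ => hg0 B v
      refine hle.trans (le_of_mul_le_mul_left ?_ (pow_pos (two_pos (α := ℝ)) (R t)))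
      rw [hmain, ← mul_assoc]
      exact mul_le_mul_of_nonneg_right (hA.trans (hpow _ _ hD0 h)) hG
    · rw [sum_comm, sum_comm (f := fun B v => g B v), mul_sum]
      refine sum_le_sum fun v _ => ?_
      let A : Finset (Matrix (Fin (R j)) (Fin n) (ZMod 2)) :=
        {M | ¬ FullOn M (S j ∩ H.free)}
      have hmain := card_mul_sum_mul_ite_mem j A (fun B => g B v) (fun B M => hgB B v M)
      set N : ℝ := (Fintype.card (Matrix (Fin (R j)) (Fin n) (ZMod 2)) : ℝ) with hN
      have hNpos : 0 < N := by rw [hN]; exact_mod_cast Fintype.card_pos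
      have hA : (#A : ℝ) * 2 ^ #(S j ∩ H.free) ≤ 2 ^ R j * N := by
        have := card_not_fullOn_mul_le (R := R j) (S j ∩ H.free)
        rw [hN]
        exact_mod_cast this
      have hA' : (#A : ℝ) ≤ N * Real.exp (lam * D) := by
        refine le_of_mul_le_mul_right ?_ (pow_pos (two_pos (α := ℝ)) #(S j ∩ H.free))
        refine hA.trans ?_
        nlinarith [hpow _ _ hD0 h]
      have hle : ∑ B, g B v * (if Exposed S B v t j H then 1 else 0) ≤
          ∑ B, g B v * (if B j ∈ A then 1 else 0) :=
        sum_le_sum fun B _ => mul_le_mul_of_nonneg_left (hind fun hE => by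
          simpa [A] using hE.2) (hg0 B v)
      have hG : 0 ≤ ∑ B, g B v := sum_nonneg fun B _ => hg0 B v
      refine hle.trans (le_of_mul_le_mul_left ?_ hNpos)
      rw [hmain, ← mul_assoc]
      exact mul_le_mul_of_nonneg_right hA' hG

end sols

/-! ### Random partitions into blocks -/

section blocks

variable {n r : ℕ}

/-- The blocks of the partition `b` after the coordinates have been permuted by `σ`. -/
def blockOf (b : Fin n → Fin r) (σ : Equiv.Perm (Fin n)) (i : Fin r) : Finset (Fin n) :=
  {x | b (σ x) = i}

theorem mem_blockOf {b : Fin n → Fin r} {σ : Equiv.Perm (Fin n)} {i : Fin r} {x : Fin n} :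
    x ∈ blockOf b σ i ↔ b (σ x) = i := by simp [blockOf]

theorem disjoint_blockOf (b : Fin n → Fin r) (σ : Equiv.Perm (Fin n)) (i j : Fin r) (h : i ≠ j) :
    Disjoint (blockOf b σ i) (blockOf b σ j) := by
  rw [disjoint_left]
  intro x hx hx'
  rw [mem_blockOf] at hx hx'
  exact h (hx.symm.trans hx')

theorem blockOf_swap_mul (b : Fin n → Fin r) (σ : Equiv.Perm (Fin n)) {p q : Fin n} {i : Fin r}
    (hp : b p ≠ i) (hq : b q ≠ i) : blockOf b (Equiv.swap p q * σ) i = blockOf b σ i := by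
  ext x
  rw [mem_blockOf, mem_blockOf, Equiv.Perm.mul_apply]
  by_cases h1 : σ x = p
  · rw [h1, Equiv.swap_apply_left]; exact iff_of_false hq hp
  · by_cases h2 : σ x = q
    · rw [h2, Equiv.swap_apply_right]; exact iff_of_false hp hq
    · rw [Equiv.swap_apply_of_ne_of_ne h1 h2]

theorem card_blockOf_inter (b : Fin n → Fin r) (σ : Equiv.Perm (Fin n)) (i : Fin r)
    (F : Finset (Fin n)) :
    (#(blockOf b σ i ∩ F) : ℝ) = ∑ y with b y = i, if σ.symm y ∈ F then 1 else 0 := by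
  rw [sum_boole, filter_filter]
  congr 1
  refine card_bij' (fun x _ => σ x) (fun y _ => σ.symm y) ?_ ?_ ?_ ?_ <;>
    simp [blockOf]

theorem card_blockOf (b : Fin n → Fin r) (σ : Equiv.Perm (Fin n)) (i : Fin r) :
    #(blockOf b σ i) = #{y | b y = i} := by
  refine card_bij' (fun x _ => σ x) (fun y _ => σ.symm y) ?_ ?_ ?_ ?_ <;>
    simp [blockOf]

/-- Block sizes may differ by one; this selects exactly `q` points of a block, so that two blocks
can be paired off. -/
theorem exists_injective_of_le_card (F : Finset (Fin n)) {q : ℕ} (h : q ≤ #F) :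
    ∃ p : Fin q → Fin n, Function.Injective p ∧ (∀ l, p l ∈ F) ∧ ∀ f : Fin n → ℝ,
      (∀ y, 0 ≤ f y ∧ f y ≤ 1) → ∑ l, f (p l) ≤ ∑ y ∈ F, f y ∧
        ∑ y ∈ F, f y ≤ ∑ l, f (p l) + (#F - q) := by
  obtain ⟨P, hPF, hP⟩ := exists_subset_card_eq h
  let e := P.equivFinOfCardEq hP
  refine ⟨fun l => e.symm l, Subtype.val_injective.comp e.symm.injective,
    fun l => hPF (e.symm l).2, fun f hf => ?_⟩
  have h1 : ∑ l, f (e.symm l) = ∑ y ∈ P, f y := by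
    rw [Equiv.sum_comp e.symm fun y : P => f y, sum_coe_sort P f]
  rw [h1, ← sum_sdiff hPF]
  have h2 : ∑ y ∈ F \ P, f y ≤ #F - q := by
    calc ∑ y ∈ F \ P, f y ≤ ∑ y ∈ F \ P, 1 := sum_le_sum fun y _ => (hf y).2
      _ = #F - q := by
        rw [sum_const, card_sdiff_of_subset hPF, hP, nsmul_eq_mul, Nat.cast_sub h, mul_one]
  have h3 : 0 ≤ ∑ y ∈ F \ P, f y := sum_nonneg fun y _ => (hf y).1
  constructor <;> linarith

/-- Pair `q` points of block `t` with `q` points of block `j`. Swapping a pair negates its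
contribution and keeps the others, so symmetrization gives `cosh lam ^ q`. The extra `lam` in the
exponent pays for a possible unpaired point of block `t`. -/
theorem sum_perm_mul_exp_le {b : Fin n → Fin r} {q : ℕ} {t j : Fin r} (htj : t ≠ j)
    (ht : q ≤ #{y | b y = t}) (ht' : #{y | b y = t} ≤ q + 1) (hj : q ≤ #{y | b y = j})
    (F : Finset (Fin n)) (g : Equiv.Perm (Fin n) → ℝ) (hg0 : ∀ σ, 0 ≤ g σ)
    (hg : ∀ σ x y, b x = t → b y = j → g (Equiv.swap x y * σ) = g σ) {lam : ℝ}
    (hlam : 0 ≤ lam) :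
    ∑ σ, g σ * Real.exp (lam * ((#(blockOf b σ t ∩ F) : ℝ) - #(blockOf b σ j ∩ F))) ≤
      Real.exp (lam + q * (lam ^ 2 / 2)) * ∑ σ, g σ := by
  obtain ⟨x, hx, hxt, hxs⟩ := exists_injective_of_le_card _ ht
  obtain ⟨y, hy, hyj, hys⟩ := exists_injective_of_le_card _ hj
  simp only [mem_filter, mem_univ, true_and] at hxt hyj
  have hxy : ∀ l l', x l ≠ y l' := fun l l' h => htj (by rw [← hxt l, h, hyj])
  let ind : Equiv.Perm (Fin n) → Fin n → ℝ := fun σ z => if σ.symm z ∈ F then 1 else 0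
  have hind : ∀ σ z, 0 ≤ ind σ z ∧ ind σ z ≤ 1 := by
    intro σ z; dsimp only [ind]; split_ifs <;> norm_num
  let d : Fin q → Equiv.Perm (Fin n) → ℝ := fun l σ => ind σ (x l) - ind σ (y l)
  have hswap : ∀ l σ z, ind (Equiv.swap (x l) (y l) * σ) z =
      ind σ (Equiv.swap (x l) (y l) z) := by
    intro l σ z
    have : (Equiv.swap (x l) (y l) * σ).symm z = σ.symm (Equiv.swap (x l) (y l) z) := by
      rw [Equiv.symm_apply_eq]; simp
    simp only [ind, this]
  have hmain := sum_mul_exp_le lam (fun l => Equiv.mulLeft (Equiv.swap (x l) (y l))) d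
    (fun l σ => by
      have h1 := hind σ (x l)
      have h2 := hind σ (y l)
      rw [abs_le]
      constructor <;> dsimp only [d] <;> linarith [h1.1, h1.2, h2.1, h2.2])
    (fun l σ => by simp [d, hswap])
    (fun l l' σ hl => by
      simp only [d, Equiv.coe_mulLeft, hswap]
      rw [Equiv.swap_apply_of_ne_of_ne (hx.ne hl) (hxy _ _),
        Equiv.swap_apply_of_ne_of_ne (hxy _ _).symm (hy.ne hl)])
    g hg0 (fun l σ => hg σ _ _ (hxt l) (hyj l)) univ
  have hG : 0 ≤ ∑ σ, g σ := sum_nonneg fun σ _ => hg0 σ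
  calc _ ≤ ∑ σ, Real.exp lam * (g σ * Real.exp (lam * ∑ l, d l σ)) := by
        refine sum_le_sum fun σ _ => ?_
        rw [mul_left_comm, ← Real.exp_add]
        refine mul_le_mul_of_nonneg_left (Real.exp_le_exp.2 ?_) (hg0 σ)
        rw [card_blockOf_inter, card_blockOf_inter, ← mul_one_add]
        refine mul_le_mul_of_nonneg_left ?_ hlam
        have h1 := (hxs (ind σ) (hind σ)).2
        have h2 := (hys (ind σ) (hind σ)).1
        have h3 : (#{y | b y = t} : ℝ) ≤ q + 1 := by exact_mod_cast ht'
        simp only [d, sum_sub_distrib]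
        simp only [ind] at h1 h2 ⊢
        linarith
    _ ≤ Real.exp lam * (Real.cosh lam ^ q * ∑ σ, g σ) := by
        rw [← mul_sum]
        refine mul_le_mul_of_nonneg_left ?_ (Real.exp_pos _).le
        simpa using hmain
    _ ≤ _ := by
        rw [Real.exp_add, mul_assoc]
        refine mul_le_mul_of_nonneg_left (mul_le_mul_of_nonneg_right ?_ hG) (Real.exp_pos _).le
        rw [Real.exp_nat_mul]
        exact pow_le_pow_left₀ (Real.cosh_pos _).le (Real.cosh_le_exp_half_sq lam) q

open Classical in
theorem sum_perm_mul_exposed_le {R : Fin r → ℕ} {b : Fin n → Fin r} {q : ℕ} {t j : Fin r}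
    (htj : t ≠ j) (ht : q ≤ #{y | b y = t}) (ht' : #{y | b y = t} ≤ q + 1)
    (hj : q ≤ #{y | b y = j}) (H : Query n)
    (g : Equiv.Perm (Fin n) → (∀ i, Matrix (Fin (R i)) (Fin n) (ZMod 2)) →
      (∀ i, Fin (R i) → ZMod 2) → ℝ) (hg0 : ∀ σ B v, 0 ≤ g σ B v)
    (hgσ : ∀ σ B v x y, b x = t → b y = j → g (Equiv.swap x y * σ) B v = g σ B v)
    (hgv : ∀ σ B v a, g σ B (Function.update v t a) = g σ B v)
    (hgB : ∀ σ B v M, g σ (Function.update B j M) v = g σ B v) {lam : ℝ} (hlam0 : 0 ≤ lam)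
    (hlam : lam ≤ Real.log 2 / 2) :
    ∑ σ, ∑ B, ∑ v, g σ B v * (if Exposed (blockOf b σ) B v t j H then 1 else 0) ≤
      Real.exp (lam + q * (lam ^ 2 / 2) - lam * (R t - R j)) * ∑ σ, ∑ B, ∑ v, g σ B v := by
  have hmain := sum_perm_mul_exp_le htj ht ht' hj H.free (fun σ => ∑ B, ∑ v, g σ B v)
    (fun σ => sum_nonneg fun B _ => sum_nonneg fun v _ => hg0 σ B v)
    (fun σ x y hx hy => sum_congr rfl fun B _ => sum_congr rfl fun v _ => hgσ σ B v x y hx hy)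
    hlam0
  calc _ ≤ ∑ σ, Real.exp (-(lam * (R t - R j))) * ((∑ B, ∑ v, g σ B v) *
        Real.exp (lam * ((#(blockOf b σ t ∩ H.free) : ℝ) - #(blockOf b σ j ∩ H.free)))) := by
        refine sum_le_sum fun σ _ => (sum_mul_exposed_le (blockOf b σ) t j H (g σ) (hg0 σ)
          (hgv σ) (hgB σ) hlam0 hlam).trans_eq ?_
        rw [mul_left_comm, ← Real.exp_add, mul_comm]
        congr 2
        ring
    _ ≤ _ := by
        rw [← mul_sum]
        refine (mul_le_mul_of_nonneg_left hmain (Real.exp_pos _).le).trans_eq ?_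
        rw [← mul_assoc, ← Real.exp_add]
        congr 2
        ring

end blocks

/-! ### The random ensemble and the comparison of real and simulated runs -/

section ensemble

variable {n r : ℕ}

/-- The random choices that determine a block instance: a permutation of the coordinates, and for
each block a matrix (of which only the columns in the block are used) and a right-hand side. -/
abbrev Ensemble (n : ℕ) {r : ℕ} (R : Fin r → ℕ) : Type :=
  Equiv.Perm (Fin n) × (∀ i, Matrix (Fin (R i)) (Fin n) (ZMod 2)) × (∀ i, Fin (R i) → ZMod 2)

variable {R : Fin r → ℕ}

/-- The simulated oracle of a member of the ensemble. -/
noncomputable abbrev Ensemble.sim (κ : ℝ) (b : Fin n → Fin r) (ω : Ensemble n R) :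
    ℕ → Query n → ℝ :=
  simOracle κ (blockOf b ω.1) ω.2.1 ω.2.2

theorem Ensemble.sim_congr (κ : ℝ) (b : Fin n → Fin r) (ω ω' : Ensemble n R) (t : ℕ)
    (hσ : ∀ i : Fin r, i.val < t → blockOf b ω.1 i = blockOf b ω'.1 i)
    (hB : ∀ i : Fin r, i.val < t → ω.2.1 i = ω'.2.1 i)
    (hv : ∀ i : Fin r, i.val < t → ω.2.2 i = ω'.2.2 i) :
    ∀ s < t, ω.sim κ b s = ω'.sim κ b s := fun _ hs =>
  simOracle_congr κ (fun i hi => hσ i (hi.trans_lt hs)) (fun i hi => hB i (hi.trans_lt hs))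
    fun i hi => hv i (hi.trans_lt hs)

open Classical in
-- Whether `H` is asked in round `t` of the simulated run depends on blocks before `t` only. It is
-- therefore unchanged by resampling `v t` or `B j` and by swapping coordinates between blocks `t`
-- and `j`. Summing over `H` then costs only the query budget `k`.
theorem sum_exposed_le {b : Fin n → Fin r} {q : ℕ}
    (hq : ∀ i, q ≤ #{y | b y = i} ∧ #{y | b y = i} ≤ q + 1) {T : ℕ} (A : RoundAlg n T) {k : ℝ}
    (hk : 0 ≤ k) (hA : A.QueriesAtMost k) (κ : ℝ) {lam ε : ℝ} (hlam0 : 0 ≤ lam)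
    (hlam : lam ≤ Real.log 2 / 2) {t j : Fin r} (htj : t < j)
    (hε : Real.exp (lam + q * (lam ^ 2 / 2) - lam * (R t - R j)) ≤ ε) :
    ∑ ω : Ensemble n R, ∑ H, (if H ∈ A.queriesWith (ω.sim κ b) t then (1 : ℝ) else 0) *
        (if Exposed (blockOf b ω.1) ω.2.1 ω.2.2 t j H then 1 else 0) ≤
      ε * (k * Fintype.card (Ensemble n R)) := by
  have hε0 : 0 ≤ ε := (Real.exp_pos _).le.trans hε
  have hH : ∀ H : Query n,
      ∑ ω : Ensemble n R, (if H ∈ A.queriesWith (ω.sim κ b) t then (1 : ℝ) else 0) *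
        (if Exposed (blockOf b ω.1) ω.2.1 ω.2.2 t j H then 1 else 0) ≤
      ε * ∑ ω : Ensemble n R, (if H ∈ A.queriesWith (ω.sim κ b) t then (1 : ℝ) else 0) := by
    intro H
    have hcongr : ∀ ω ω' : Ensemble n R,
        (∀ i : Fin r, i.val < t.val → blockOf b ω.1 i = blockOf b ω'.1 i) →
        (∀ i : Fin r, i.val < t.val → ω.2.1 i = ω'.2.1 i) →
        (∀ i : Fin r, i.val < t.val → ω.2.2 i = ω'.2.2 i) →
        (if H ∈ A.queriesWith (ω.sim κ b) t then (1 : ℝ) else 0) =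
          if H ∈ A.queriesWith (ω'.sim κ b) t then (1 : ℝ) else 0 := by
      intro ω ω' h1 h2 h3
      rw [A.queriesWith_congr t.val (Ensemble.sim_congr κ b ω ω' t.val h1 h2 h3)]
    have hmain := sum_perm_mul_exposed_le (R := R) htj.ne (hq t).1 (hq t).2 (hq j).1 H
      (fun σ B v => if H ∈ A.queriesWith (Ensemble.sim κ b (σ, B, v)) t then (1 : ℝ) else 0)
      (fun σ B v => by split_ifs <;> norm_num)
      (fun σ B v x y hx hy => hcongr _ _ (fun i hi => blockOf_swap_mul b σ
        (by rw [hx]; exact (Fin.ne_of_lt hi).symm)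
        (by rw [hy]; exact (Fin.ne_of_lt (hi.trans htj)).symm)) (fun _ _ => rfl) fun _ _ => rfl)
      (fun σ B v a => hcongr _ _ (fun _ _ => rfl) (fun _ _ => rfl) fun i hi =>
        Function.update_of_ne (Fin.ne_of_lt hi) _ _)
      (fun σ B v M => hcongr _ _ (fun _ _ => rfl) (fun i hi =>
        Function.update_of_ne (Fin.ne_of_lt (hi.trans htj)) _ _) fun _ _ => rfl)
      hlam0 hlam
    simp only [Fintype.sum_prod_type]
    exact hmain.trans (mul_le_mul_of_nonneg_right hε (sum_nonneg fun σ _ => sum_nonneg fun B _ =>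
      sum_nonneg fun v _ => by split_ifs <;> norm_num))
  rw [sum_comm]
  refine (sum_le_sum fun H _ => hH H).trans ?_
  rw [← mul_sum, sum_comm]
  refine mul_le_mul_of_nonneg_left ?_ hε0
  calc _ ≤ ∑ ω : Ensemble n R, k := sum_le_sum fun ω _ => by
        simpa using A.card_queriesWith_le hk hA (ω.sim κ b) t
    _ = _ := by simp [mul_comm]

theorem sum_runWith_last_le {b : Fin n → Fin r} {T : ℕ} (A : RoundAlg n T) (κ : ℝ) {i : Fin r}
    (hi : T ≤ i.val) :
    ∑ ω : Ensemble n R, (if mulOn (blockOf b ω.1 i) (ω.2.1 i) (A.runWith (ω.sim κ b)) = ω.2.2 i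
        then (1 : ℝ) else 0) ≤ (1 / 2) ^ R i * Fintype.card (Ensemble n R) := by
  have key : ∀ (σ : Equiv.Perm (Fin n)) (B : ∀ i, Matrix (Fin (R i)) (Fin n) (ZMod 2)),
      ∑ v, (if mulOn (blockOf b σ i) (B i) (A.runWith (Ensemble.sim κ b (σ, B, v))) = v i
        then (1 : ℝ) else 0) =
      (1 / 2) ^ R i * ∑ v : (∀ i, Fin (R i) → ZMod 2), 1 := by
    intro σ B
    -- Splitting by the value `x` of the output makes the target for `v i` a fixed vector.
    have hx : ∀ x : Cube n, ∑ v, (if A.runWith (Ensemble.sim κ b (σ, B, v)) = x then (1 : ℝ) else 0)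
        * (if v i ∈ ({mulOn (blockOf b σ i) (B i) x} : Finset (Fin (R i) → ZMod 2)) then 1 else 0) =
        (1 / 2) ^ R i *
          ∑ v, (if A.runWith (Ensemble.sim κ b (σ, B, v)) = x then (1 : ℝ) else 0) := by
      intro x
      have h := card_mul_sum_mul_ite_mem i
        ({mulOn (blockOf b σ i) (B i) x} : Finset (Fin (R i) → ZMod 2))
        (fun v => if A.runWith (Ensemble.sim κ b (σ, B, v)) = x then (1 : ℝ) else 0)
        (fun v a => by
          rw [A.runWith_congr (Ensemble.sim_congr κ b (σ, B, Function.update v i a) (σ, B, v) T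
            (fun _ _ => rfl) (fun _ _ => rfl) fun j hj =>
              Function.update_of_ne (Fin.ne_of_lt (hj.trans_le hi)) _ _)])
      have hcard : (Fintype.card (Fin (R i) → ZMod 2) : ℝ) = 2 ^ R i := by simp
      rw [hcard, card_singleton, Nat.cast_one, one_mul] at h
      rw [← h, ← mul_assoc, ← mul_pow]
      norm_num
    have hsum := sum_congr rfl fun x (_ : x ∈ (univ : Finset (Cube n))) => hx x
    rw [← mul_sum, sum_comm, sum_comm (s := (univ : Finset (Cube n)))] at hsum
    convert hsum using 2
    · rename_i v _
      rw [sum_eq_single (A.runWith (Ensemble.sim κ b (σ, B, v)))]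
      · simp [eq_comm]
      · intro x _ hx'
        simp [hx'.symm]
      · simp
    · refine sum_congr rfl fun v _ => by simp
  have : (Fintype.card (Ensemble n R) : ℝ) = ∑ ω : Ensemble n R, 1 := by simp
  rw [this, Fintype.sum_prod_type, Fintype.sum_prod_type, mul_sum]
  refine sum_le_sum fun σ _ => ?_
  rw [Fintype.sum_prod_type, Fintype.sum_prod_type, mul_sum]
  exact sum_le_sum fun B _ => (key σ B).le

open Classical in
/-- A deterministic algorithm with few rounds rarely finds a solution of a random instance. -/
theorem sum_run_le {b : Fin n → Fin r} {q : ℕ}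
    (hq : ∀ i, q ≤ #{y | b y = i} ∧ #{y | b y = i} ≤ q + 1) {T : ℕ} (A : RoundAlg n T) {k : ℝ}
    (hk : 0 ≤ k) (hA : A.QueriesAtMost k) (κ : ℝ) {lam ε : ℝ} (hlam0 : 0 ≤ lam)
    (hlam : lam ≤ Real.log 2 / 2)
    (hε : ∀ t j, t < j → Real.exp (lam + q * (lam ^ 2 / 2) - lam * (R t - R j)) ≤ ε)
    (hε0 : 0 ≤ ε) {i : Fin r} (hi : T ≤ i.val) :
    ∑ ω : Ensemble n R, (if ∀ i, mulOn (blockOf b ω.1 i) (ω.2.1 i)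
        (A.run fun H => κ * #(sols (blockOf b ω.1) ω.2.1 ω.2.2 univ H)) = ω.2.2 i
        then (1 : ℝ) else 0) ≤
      (r * (r * (ε * k)) + (1 / 2) ^ R i) * Fintype.card (Ensemble n R) := by
  have hnn : ∀ (p : Prop) [Decidable p], (0 : ℝ) ≤ if p then 1 else 0 := by
    intro p _; split_ifs <;> norm_num
  have hpt : ∀ ω : Ensemble n R, (if ∀ i, mulOn (blockOf b ω.1 i) (ω.2.1 i)
        (A.run fun H => κ * #(sols (blockOf b ω.1) ω.2.1 ω.2.2 univ H)) = ω.2.2 i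
        then (1 : ℝ) else 0) ≤
      (∑ t : Fin r, ∑ j with t < j, ∑ H,
        (if H ∈ A.queriesWith (ω.sim κ b) t then (1 : ℝ) else 0) *
        (if Exposed (blockOf b ω.1) ω.2.1 ω.2.2 t j H then 1 else 0)) +
      if mulOn (blockOf b ω.1 i) (ω.2.1 i) (A.runWith (ω.sim κ b)) = ω.2.2 i
        then (1 : ℝ) else 0 := by
    intro ω
    -- Either simulation and truth agree on all simulated queries, and a solution must in particular
    -- solve block `i`, or some wrongly answered query is counted in the triple sum.
    by_cases hrun : ∀ t < T, ∀ H ∈ A.queriesWith (ω.sim κ b) t,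
        ω.sim κ b t H = κ * #(sols (blockOf b ω.1) ω.2.1 ω.2.2 univ H)
    · rw [A.run_eq_runWith _ hrun]
      refine le_add_of_nonneg_of_le (sum_nonneg fun t _ => sum_nonneg fun j _ =>
        sum_nonneg fun H _ => mul_nonneg (hnn _) (hnn _)) ?_
      by_cases h : ∀ i, mulOn (blockOf b ω.1 i) (ω.2.1 i) (A.runWith (ω.sim κ b)) = ω.2.2 i
      · simp [h]
      · rw [if_neg h]; exact hnn _
    · push Not at hrun
      obtain ⟨t, ht, H, hH, hne⟩ := hrun
      obtain ⟨j, htj, hexp⟩ := exists_exposed_of_simOracle_ne κ (t := ⟨t, (ht.trans_le hi).trans i.2⟩)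
        (disjoint_blockOf b ω.1) hne
      refine le_add_of_le_of_nonneg ?_ (hnn _)
      have h1 := single_le_sum (f := fun H =>
        (if H ∈ A.queriesWith (ω.sim κ b) t then (1 : ℝ) else 0) *
        (if Exposed (blockOf b ω.1) ω.2.1 ω.2.2 ⟨t, (ht.trans_le hi).trans i.2⟩ j H then 1 else 0))
        (fun H _ => mul_nonneg (hnn _) (hnn _)) (mem_univ H)
      have h2 := single_le_sum (s := {j | ⟨t, (ht.trans_le hi).trans i.2⟩ < j}) (f := fun j => ∑ H,
        (if H ∈ A.queriesWith (ω.sim κ b) t then (1 : ℝ) else 0) *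
        (if Exposed (blockOf b ω.1) ω.2.1 ω.2.2 ⟨t, (ht.trans_le hi).trans i.2⟩ j H then 1 else 0))
        (fun j _ => sum_nonneg fun H _ => mul_nonneg (hnn _) (hnn _))
        (mem_filter.2 ⟨mem_univ j, htj⟩)
      have h3 := single_le_sum (f := fun t : Fin r => ∑ j with t < j, ∑ H,
        (if H ∈ A.queriesWith (ω.sim κ b) t then (1 : ℝ) else 0) *
        (if Exposed (blockOf b ω.1) ω.2.1 ω.2.2 t j H then 1 else 0))
        (fun t _ => sum_nonneg fun j _ => sum_nonneg fun H _ => mul_nonneg (hnn _) (hnn _))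
        (mem_univ ⟨t, (ht.trans_le hi).trans i.2⟩)
      refine le_trans ?_ (h1.trans (h2.trans h3))
      simp only [hH, hexp, if_true, mul_one]
      split_ifs <;> norm_num
  refine (sum_le_sum fun ω _ => hpt ω).trans ?_
  rw [sum_add_distrib, add_mul]
  refine add_le_add ?_ (sum_runWith_last_le A κ hi)
  set N : ℝ := (Fintype.card (Ensemble n R) : ℝ) with hN
  have hb : 0 ≤ ε * (k * N) := by positivity
  rw [sum_comm]
  calc _ ≤ ∑ t : Fin r, ∑ j : Fin r, ε * (k * N) := by
        refine sum_le_sum fun t _ => ?_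
        rw [sum_comm]
        refine (sum_le_sum fun j hj => sum_exposed_le hq A hk hA κ hlam0 hlam
          (mem_filter.1 hj).2 (hε t j (mem_filter.1 hj).2)).trans ?_
        exact sum_le_sum_of_subset_of_nonneg (subset_univ _) fun _ _ _ => hb
    _ = _ := by simp; ring

open Classical in
/-- A random instance has linearly independent equations with high probability. -/
theorem sum_not_fullOn_le {b : Fin n → Fin r} {a : ℕ}
    (ha : ∀ i, R i + a ≤ #{y | b y = i}) :
    ∑ ω : Ensemble n R, (if ∀ i, FullOn (ω.2.1 i) (blockOf b ω.1 i) then (0 : ℝ) else 1) ≤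
      r * (1 / 2) ^ a * Fintype.card (Ensemble n R) := by
  have hnn : ∀ (p : Prop) [Decidable p], (0 : ℝ) ≤ if p then 1 else 0 := by
    intro p _; split_ifs <;> norm_num
  have key : ∀ (σ : Equiv.Perm (Fin n)) (i : Fin r),
      ∑ B : (∀ i, Matrix (Fin (R i)) (Fin n) (ZMod 2)),
        (if ¬ FullOn (B i) (blockOf b σ i) then (1 : ℝ) else 0) ≤
      (1 / 2) ^ a * ∑ B : (∀ i, Matrix (Fin (R i)) (Fin n) (ZMod 2)), 1 := by
    intro σ i
    have hmain := card_mul_sum_mul_ite_mem i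
      ({M | ¬ FullOn M (blockOf b σ i)} : Finset (Matrix (Fin (R i)) (Fin n) (ZMod 2)))
      (fun _ : (∀ i, Matrix (Fin (R i)) (Fin n) (ZMod 2)) => 1) (fun _ _ => rfl)
    have hc := card_not_fullOn_mul_le (R := R i) (blockOf b σ i)
    rw [card_blockOf] at hc
    set N := Fintype.card (Matrix (Fin (R i)) (Fin n) (ZMod 2)) with hN
    have hNpos : (0 : ℝ) < N := by rw [hN]; exact_mod_cast Fintype.card_pos
    set c := #({M | ¬ FullOn M (blockOf b σ i)} : Finset (Matrix (Fin (R i)) (Fin n) (ZMod 2)))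
      with hcdef
    have h1 : (c : ℝ) ≤ (1 / 2) ^ a * N := by
      have h2 : c * 2 ^ (R i + a) ≤ 2 ^ R i * N :=
        (Nat.mul_le_mul_left _ (Nat.pow_le_pow_right two_pos (ha i))).trans hc
      have h3 : c * 2 ^ a ≤ N := by
        refine Nat.le_of_mul_le_mul_left ?_ (pow_pos two_pos (R i))
        rw [pow_add] at h2
        linarith
      have h4 : (c : ℝ) * 2 ^ a ≤ N := by exact_mod_cast h3
      rw [one_div, inv_pow, inv_mul_eq_div, le_div_iff₀ (by positivity)]
      exact h4
    simp only [mem_filter, mem_univ, true_and, one_mul] at hmain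
    refine le_of_mul_le_mul_left ?_ hNpos
    rw [hmain, ← mul_assoc, mul_comm (N : ℝ)]
    exact mul_le_mul_of_nonneg_right h1 (sum_nonneg fun _ _ => zero_le_one)
  have hpt : ∀ ω : Ensemble n R,
      (if ∀ i, FullOn (ω.2.1 i) (blockOf b ω.1 i) then (0 : ℝ) else 1) ≤
        ∑ i, if ¬ FullOn (ω.2.1 i) (blockOf b ω.1 i) then (1 : ℝ) else 0 := by
    intro ω
    split_ifs with h
    · exact sum_nonneg fun i _ => hnn _
    · obtain ⟨i, hi⟩ := not_forall.1 h
      refine le_trans ?_ (single_le_sum (fun i _ => hnn _) (mem_univ i))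
      rw [if_pos hi]
  refine (sum_le_sum fun ω _ => hpt ω).trans ?_
  rw [sum_comm]
  calc _ ≤ ∑ i : Fin r, (1 / 2) ^ a * (Fintype.card (Ensemble n R) : ℝ) := by
        refine sum_le_sum fun i _ => ?_
        have : (Fintype.card (Ensemble n R) : ℝ) = ∑ ω : Ensemble n R, 1 := by simp
        rw [this, Fintype.sum_prod_type, Fintype.sum_prod_type, mul_sum]
        refine sum_le_sum fun σ _ => ?_
        rw [Fintype.sum_prod_type, Fintype.sum_prod_type, sum_comm,
          sum_comm (f := fun _ _ => (1 : ℝ)), mul_sum]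
        exact sum_le_sum fun v _ => key σ i
    _ = _ := by simp; ring

end ensemble

/-! ### From random choices to instances -/

/-- Averaging over seeds and instances: at least half of the instances satisfy `V`, so they cannot
all fail by more than twice the mean. -/
theorem exists_measureReal_le_of_forall_sum_le {Ω S : Type*} [Fintype Ω] [Nonempty Ω]
    [MeasurableSpace S] (μ : Measure S) [IsProbabilityMeasure μ] (E : Ω → Set S)
    (hE : ∀ ω, MeasurableSet (E ω)) (V : Ω → Prop) [DecidablePred V] {η : ℝ}
    (hV : ∑ ω, (if V ω then (0 : ℝ) else 1) ≤ 1 / 2 * Fintype.card Ω)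
    (hη : ∀ s, ∑ ω, (E ω).indicator (1 : S → ℝ) s ≤ η * Fintype.card Ω) :
    ∃ ω, V ω ∧ μ.real (E ω) ≤ 2 * η := by
  by_contra! hcon
  have hN : (0 : ℝ) < Fintype.card Ω := by exact_mod_cast Fintype.card_pos
  have hint : ∀ ω, Integrable ((E ω).indicator (1 : S → ℝ)) μ := fun ω =>
    (integrable_const (1 : ℝ)).indicator (hE ω)
  have hsum : ∑ ω, μ.real (E ω) ≤ η * Fintype.card Ω := by
    calc ∑ ω, μ.real (E ω) = ∑ ω, ∫ s, (E ω).indicator (1 : S → ℝ) s ∂μ :=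
          sum_congr rfl fun ω _ => (integral_indicator_one (hE ω)).symm
      _ = ∫ s, ∑ ω, (E ω).indicator (1 : S → ℝ) s ∂μ :=
          (integral_finsetSum _ fun ω _ => hint ω).symm
      _ ≤ ∫ _, η * Fintype.card Ω ∂μ :=
          integral_mono (integrable_finsetSum _ fun ω _ => hint ω) (integrable_const _) hη
      _ = _ := by simp
  have hη0 : 0 ≤ η := by
    have : 0 ≤ η * Fintype.card Ω := (sum_nonneg fun ω _ => measureReal_nonneg).trans hsum
    exact nonneg_of_mul_nonneg_left this hN
  have hpt : ∀ ω, 2 * η * (1 - if V ω then (0 : ℝ) else 1) ≤ μ.real (E ω) := by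
    intro ω
    split_ifs with h
    · linarith [hcon ω h]
    · simp
  have hVE : ∃ ω, V ω := by
    by_contra! hno
    simp [hno] at hV
    linarith
  obtain ⟨ω₀, hω₀⟩ := hVE
  have hlt : ∑ ω, 2 * η * (1 - if V ω then (0 : ℝ) else 1) < ∑ ω, μ.real (E ω) :=
    sum_lt_sum (fun ω _ => hpt ω) ⟨ω₀, mem_univ _, by simpa [hω₀] using hcon ω₀ hω₀⟩
  rw [← mul_sum, sum_sub_distrib] at hlt
  simp only [sum_const, card_univ, nsmul_eq_mul, mul_one] at hlt
  nlinarith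

namespace Ensemble

variable {n r : ℕ} {R a : Fin r → ℕ} {b : Fin n → Fin r}

/-- The query without pinned coordinates. -/
def _root_.Query.whole (n : ℕ) : Query n := fun _ => none

theorem _root_.Query.subcube_whole (n : ℕ) : (Query.whole n).subcube = Set.univ := by
  ext x; simp [Query.subcube, Query.whole]

theorem _root_.Query.free_whole (n : ℕ) : (Query.whole n).free = univ := by
  ext x; simp [Query.free, Query.whole]

theorem card_block (b : Fin n → Fin r) (σ : Equiv.Perm (Fin n)) (i : Fin r) :
    Fintype.card {j // b (σ j) = i} = #{y | b y = i} := by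
  rw [← card_blockOf b σ i, blockOf, Fintype.card_subtype]

/-- The block code given by a member of the ensemble with independent equations. -/
def toBlockCode (ω : Ensemble n R)
    (hb : ∀ i, #{y | b y = i} = n / r ∨ #{y | b y = i} = n / r + 1)
    (hR : ∀ i, R i + a i = #{y | b y = i})
    (hω : ∀ i, FullOn (ω.2.1 i) (blockOf b ω.1 i)) : BlockCode n r a where
  block j := b (ω.1 j)
  card_block i := by rw [card_block]; exact hb i
  rows := R
  rows_add i := by rw [card_block]; exact hR i
  B i := fun l j => ω.2.1 i l j.1
  v := ω.2.2
  linearIndependent_rows i := by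
    rw [Fintype.linearIndependent_iff]
    intro u hu l
    refine congrFun (hω i u fun j hj => ?_) l
    simpa [Matrix.row] using congrFun hu ⟨j, mem_blockOf.1 hj⟩

variable (ω : Ensemble n R) (hb : ∀ i, #{y | b y = i} = n / r ∨ #{y | b y = i} = n / r + 1)
  (hR : ∀ i, R i + a i = #{y | b y = i}) (hω : ∀ i, FullOn (ω.2.1 i) (blockOf b ω.1 i))

theorem mem_support_toBlockCode {x : Cube n} :
    x ∈ (ω.toBlockCode hb hR hω).support ↔
      ∀ i, mulOn (blockOf b ω.1 i) (ω.2.1 i) x = ω.2.2 i := by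
  refine forall_congr' fun i => ?_
  have : ((ω.toBlockCode hb hR hω).B i).mulVec (fun j => x j.1) =
      mulOn (blockOf b ω.1 i) (ω.2.1 i) x := by
    ext l
    simp only [toBlockCode, Matrix.mulVec, dotProduct, mulOn, blockOf]
    exact (sum_subtype (p := fun j => b (ω.1 j) = i) _ (by simp)
      fun j => ω.2.1 i l j * x j).symm
  rw [this]
  rfl

theorem countingOracle_mu :
    countingOracle (ω.toBlockCode hb hR hω).mu =
      fun H => (#(sols (blockOf b ω.1) ω.2.1 ω.2.2 univ H) : ℝ) := by
  classical
  ext H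
  rw [countingOracle, sols, ← sum_boole]
  refine sum_congr rfl fun x _ => ?_
  have := ω.mem_support_toBlockCode hb hR hω (x := x)
  simp only [BlockCode.mu, Set.indicator, this, mem_univ, forall_const, ← ite_and, Pi.one_apply]

/-- The number of solutions is the same for all nondegenerate instances, so the normalization `κ` of
the sampling oracle can be fixed before the instance is chosen. -/
theorem card_sols_whole (hω : ∀ i, FullOn (ω.2.1 i) (blockOf b ω.1 i)) :
    (#(sols (blockOf b ω.1) ω.2.1 ω.2.2 univ (Query.whole n)) : ℝ) =
      2 ^ n / 2 ^ ∑ i, R i := by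
  have h := card_sols_union (disjoint_blockOf b ω.1) ω.2.1 ω.2.2 (Query.whole n) ∅ univ
    (disjoint_empty_left _) fun i _ => by simpa [Query.free_whole] using hω i
  have h0 : #(sols (blockOf b ω.1) ω.2.1 ω.2.2 ∅ (Query.whole n)) = 2 ^ n := by
    simp [sols, Query.subcube_whole]
  rw [h0, empty_union] at h
  rw [eq_div_iff (by positivity)]
  exact_mod_cast h

theorem sum_mu : ∑ x, (ω.toBlockCode hb hR hω).mu x = 2 ^ n / 2 ^ ∑ i, R i := by
  rw [← ω.card_sols_whole hω, ← congrFun (ω.countingOracle_mu hb hR hω) (Query.whole n)]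
  simp [countingOracle, Query.subcube_whole]

theorem countingOracle_uniform :
    countingOracle (ω.toBlockCode hb hR hω).uniform =
      fun H => (2 ^ n / 2 ^ ∑ i, R i : ℝ)⁻¹ * #(sols (blockOf b ω.1) ω.2.1 ω.2.2 univ H) := by
  ext H
  rw [← congrFun (ω.countingOracle_mu hb hR hω) H, ← ω.sum_mu hb hR hω, countingOracle,
    countingOracle, mul_sum]
  refine sum_congr rfl fun x _ => ?_
  simp only [BlockCode.uniform, Set.indicator]
  split_ifs <;> simp [div_eq_inv_mul]

theorem nonempty_support : (ω.toBlockCode hb hR hω).support.Nonempty := by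
  have h := ω.card_sols_whole hω
  have hpos : (0 : ℝ) < #(sols (blockOf b ω.1) ω.2.1 ω.2.2 univ (Query.whole n)) := by
    rw [h]; positivity
  obtain ⟨x, hx⟩ := card_pos.1 (Nat.cast_pos.1 hpos)
  exact ⟨x, (ω.mem_support_toBlockCode hb hR hω).2 fun i => (mem_sols.1 hx).2 i (mem_univ i)⟩

end Ensemble

namespace BlockCode

variable {n r : ℕ} {a : Fin r → ℕ} (I : BlockCode n r a)

/-- The solutions as an affine subspace. -/
def affineSupport : AffineSubspace (ZMod 2) (Cube n) where
  carrier := I.support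
  smul_vsub_vadd_mem' := by
    intro c x y z hx hy hz i
    have : (fun j : {j // I.block j = i} => (c • (x -ᵥ y) +ᵥ z) j.1) =
        c • ((fun j => x j.1) - fun j => y j.1) + fun j => z j.1 := by
      ext j; simp
    rw [this, Matrix.mulVec_add, Matrix.mulVec_smul, Matrix.mulVec_sub, hx i, hy i, hz i]
    simp

end BlockCode

/-! ### Randomized algorithms -/

namespace RandAlg

variable {n T : ℕ} (A : RandAlg.{u} n T)

theorem measurableSet_run_mem (O : Query n → ℝ) (s : Set (Cube n)) :
    @MeasurableSet _ A.measurableSpace {ω | (A.alg ω).run O ∈ s} := by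
  let := A.measurableSpace
  have : {ω | (A.alg ω).run O ∈ s} = ⋃ x ∈ s, {ω | (A.alg ω).run O = x} := by
    ext ω; simp
  rw [this]
  exact MeasurableSet.biUnion s.to_countable fun x _ => A.measurableSet_run O x

theorem sum_outputProb_singleton (O : Query n → ℝ) (s : Finset (Cube n)) :
    ∑ x ∈ s, A.outputProb O {x} = A.outputProb O s := by
  let := A.measurableSpace
  have := A.isProbabilityMeasure
  have : {ω | (A.alg ω).run O ∈ (s : Set (Cube n))} = ⋃ x ∈ s, {ω | (A.alg ω).run O = x} := by
    ext ω; simp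
  rw [outputProb, this, measureReal_biUnion_finset]
  · rfl
  · intro x _ y _ hxy
    exact Set.disjoint_left.2 fun ω h1 h2 => hxy (h1.symm.trans h2)
  · exact fun x _ => A.measurableSet_run O x

theorem outputProb_univ (O : Query n → ℝ) : A.outputProb O Set.univ = 1 := by
  let := A.measurableSpace
  have := A.isProbabilityMeasure
  simp [outputProb]

/-- An algorithm that rarely outputs a solution is far from the uniform distribution on them. -/
theorem one_sub_outputProb_le_tvDist {r : ℕ} {a : Fin r → ℕ} (I : BlockCode n r a)
    (hI : ∑ x, I.mu x ≠ 0) (O : Query n → ℝ) :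
    1 - A.outputProb O I.support ≤ tvDist (fun x => A.outputProb O {x}) I.uniform := by
  classical
  let s : Finset (Cube n) := {x | x ∈ I.support}
  have hs : (s : Set (Cube n)) = I.support := by ext; simp [s]
  have hu : ∑ x, I.uniform x = 1 := by
    simp only [BlockCode.uniform]
    rw [← sum_div, div_self hI]
  have h0 : ∀ x ∈ sᶜ, I.uniform x = 0 := by
    intro x hx
    have : x ∉ I.support := by simpa [s] using hx
    simp [BlockCode.uniform, BlockCode.mu, this]
  have hus : ∑ x ∈ s, I.uniform x = 1 := by
    rw [← hu, ← sum_add_sum_compl s, sum_eq_zero h0, add_zero]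
  have ho : ∑ x ∈ s, A.outputProb O {x} = A.outputProb O I.support := by
    rw [A.sum_outputProb_singleton, hs]
  have hoc : ∑ x ∈ sᶜ, A.outputProb O {x} = 1 - A.outputProb O I.support := by
    have := A.sum_outputProb_singleton O univ
    rw [coe_univ, outputProb_univ, ← sum_add_sum_compl s, ho] at this
    linarith
  rw [tvDist, ← sum_add_sum_compl s]
  -- The solutions and their complement each contribute this much, which cancels the factor `1 / 2`
  -- in `tvDist`.
  have h1 : 1 - A.outputProb O I.support ≤ ∑ x ∈ s, |A.outputProb O {x} - I.uniform x| := by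
    rw [← ho, ← hus, ← sum_sub_distrib]
    exact sum_le_sum fun x _ => by rw [abs_sub_comm]; exact le_abs_self _
  have h2 : 1 - A.outputProb O I.support ≤ ∑ x ∈ sᶜ, |A.outputProb O {x} - I.uniform x| := by
    rw [← hoc]
    exact sum_le_sum fun x hx => by rw [h0 x hx, sub_zero]; exact le_abs_self _
  linarith

open Classical in
/-- Some instance of the ensemble is hard for a randomized algorithm with few rounds. -/
theorem exists_outputProb_le {r : ℕ} {R a : Fin r → ℕ} {b : Fin n → Fin r}
    (hb : ∀ i, #{y | b y = i} = n / r ∨ #{y | b y = i} = n / r + 1)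
    (hR : ∀ i, R i + a i = #{y | b y = i}) {k : ℝ} (hk : 0 ≤ k) (hA : A.QueriesAtMost k) (κ : ℝ)
    {lam ε : ℝ} (hlam0 : 0 ≤ lam) (hlam : lam ≤ Real.log 2 / 2) (hε0 : 0 ≤ ε)
    (hε : ∀ t j, t < j →
      Real.exp (lam + (n / r : ℕ) * (lam ^ 2 / 2) - lam * (R t - R j)) ≤ ε)
    {i : Fin r} (hi : T ≤ i.val) {d : ℕ} (hd : ∀ i, d ≤ a i)
    (hd' : (r : ℝ) * (1 / 2) ^ d ≤ 1 / 2) :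
    ∃ ω : Ensemble n R, (∀ i, FullOn (ω.2.1 i) (blockOf b ω.1 i)) ∧
      A.outputProb (fun H => κ * #(sols (blockOf b ω.1) ω.2.1 ω.2.2 univ H))
        {x | ∀ i, mulOn (blockOf b ω.1 i) (ω.2.1 i) x = ω.2.2 i} ≤
      2 * (r * (r * (ε * k)) + (1 / 2) ^ R i) := by
  let := A.measurableSpace
  have := A.isProbabilityMeasure
  have hq : ∀ i, n / r ≤ #{y | b y = i} ∧ #{y | b y = i} ≤ n / r + 1 := by
    intro i
    rcases hb i with h | h <;> omega
  refine exists_measureReal_le_of_forall_sum_le A.prob _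
    (fun ω => A.measurableSet_run_mem _ _) _ ?_ fun s => ?_
  · refine (sum_not_fullOn_le (R := R) (a := d) fun i => ?_).trans
      (mul_le_mul_of_nonneg_right hd' (Nat.cast_nonneg _))
    rw [← hR i]
    exact Nat.add_le_add_left (hd i) _
  · refine le_trans (le_of_eq ?_)
      (sum_run_le hq (A.alg s) hk (hA s) κ hlam0 hlam hε hε0 hi)
    refine sum_congr rfl fun ω _ => ?_
    simp [Set.indicator]

end RandAlg

/-- A partition of the coordinates into blocks of almost equal size. -/
theorem exists_balanced (n : ℕ) {r : ℕ} (hr : 0 < r) :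
    ∃ b : Fin n → Fin r, ∀ i, #{y | b y = i} = n / r ∨ #{y | b y = i} = n / r + 1 := by
  refine ⟨fun y => ⟨y % r, Nat.mod_lt _ hr⟩, fun i => ?_⟩
  have h := Nat.count_modEq_card n hr i.val
  have h2 : #{y : Fin n | (⟨y % r, Nat.mod_lt _ hr⟩ : Fin r) = i} =
      n.count (· ≡ i.val [MOD r]) := by
    rw [Nat.count_eq_card_filter_range]
    refine card_bij (fun y _ => y.val) ?_ (fun _ _ _ _ h => Fin.ext h) ?_
    · intro y hy
      simp only [mem_filter, mem_univ, true_and, Fin.ext_iff] at hy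
      simpa [Nat.ModEq, Nat.mod_eq_of_lt i.2] using hy
    · intro y hy
      simp only [mem_filter, mem_range, Nat.ModEq, Nat.mod_eq_of_lt i.2] at hy
      exact ⟨⟨y, hy.1⟩, by simpa [Fin.ext_iff] using hy.2, rfl⟩
  rw [h2, h]
  split_ifs <;> simp

/-! ### The parameters -/

theorem exists_params {δ : ℝ} (hδ0 : 0 < δ) (hδ1 : δ ≤ 1) :
    ∃ n₀ : ℕ, ∀ n : ℕ, n₀ ≤ n → ∀ c : ℝ, 0 < c → c < (n : ℝ) ^ (1 - δ) →
      ∃ L x : ℝ, 2 ≤ L ∧ 100 ≤ x ∧ (n : ℝ) = L * x ^ 3 ∧ roundBound n c = x / 4 ∧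
        12 * (n : ℝ) ^ (1 / 3 : ℝ) * ((c + 2) * Real.log n) ^ (2 / 3 : ℝ) = 12 * (L * x) ∧
        (n : ℝ) ^ c * (n : ℝ) ^ 2 = Real.exp L := by
  -- With `c + 2 ≤ 3 * n ^ (1 - δ)` this yields `10 ^ 6 * L ≤ n`, that is `x ≥ 100`.
  have hlog := (isLittleO_log_rpow_atTop hδ0).bound (show (0 : ℝ) < 1 / 3000000 by norm_num)
  obtain ⟨n₀, hn₀⟩ := Filter.eventually_atTop.1
    (tendsto_natCast_atTop_atTop.eventually (hlog.and (Filter.eventually_ge_atTop (3 : ℝ))))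
  refine ⟨n₀, fun n hn c hc0 hc => ?_⟩
  obtain ⟨hlogn, hn3⟩ := hn₀ n hn
  have hn0 : (0 : ℝ) < n := by linarith
  have hlog1 : 1 ≤ Real.log n := by
    rw [Real.le_log_iff_exp_le hn0]
    linarith [Real.exp_one_lt_d9]
  rw [Real.norm_of_nonneg (by linarith), Real.norm_of_nonneg (Real.rpow_nonneg hn0.le _)]
    at hlogn
  set L : ℝ := (c + 2) * Real.log n with hL
  have hL2 : 2 ≤ L := by nlinarith
  have hL0 : 0 < L := by linarith
  have hone : 1 ≤ (n : ℝ) ^ (1 - δ) := Real.one_le_rpow (by linarith) (by linarith)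
  have hmul : (n : ℝ) ^ (1 - δ) * (n : ℝ) ^ δ = n := by
    rw [← Real.rpow_add hn0]; simp
  have hLn : L * 1000000 ≤ n := by
    calc L * 1000000 ≤ (3 * (n : ℝ) ^ (1 - δ)) * Real.log n * 1000000 := by
          rw [hL]; gcongr; linarith
      _ = (n : ℝ) ^ (1 - δ) * (3000000 * Real.log n) := by ring
      _ ≤ (n : ℝ) ^ (1 - δ) * (n : ℝ) ^ δ := by gcongr; linarith
      _ = n := hmul
  set x : ℝ := ((n : ℝ) / L) ^ (1 / 3 : ℝ) with hx
  have hnL : 0 < (n : ℝ) / L := by positivity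
  have hx3 : x ^ 3 = n / L := by
    rw [hx, ← Real.rpow_natCast, ← Real.rpow_mul hnL.le]; norm_num
  have hx0 : 0 < x := Real.rpow_pos_of_pos hnL _
  have hn : (n : ℝ) = L * x ^ 3 := by rw [hx3]; field_simp
  refine ⟨L, x, hL2, ?_, hn, ?_, ?_, ?_⟩
  · refine le_of_pow_le_pow_left₀ three_ne_zero hx0.le ?_
    rw [hx3, le_div_iff₀ hL0]
    linarith
  · rw [roundBound, ← hL, ← hx]; ring
  · have h1 : (n : ℝ) ^ (1 / 3 : ℝ) = L ^ (1 / 3 : ℝ) * x := by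
      rw [hx, Real.div_rpow hn0.le hL0.le]
      field_simp
    have h2 : L ^ (1 / 3 : ℝ) * L ^ (2 / 3 : ℝ) = L := by
      rw [← Real.rpow_add hL0]; norm_num
    rw [h1]
    linear_combination 12 * x * h2
  · rw [Real.rpow_def_of_pos hn0, ← Real.rpow_natCast, Real.rpow_def_of_pos hn0, ← Real.exp_add]
    congr 1
    rw [hL]; push_cast; ring

/-- If the dimensions of the codes grow by `12 * L * x` from block to block, then some instance is
hard for a randomized algorithm with few rounds. -/
theorem exists_hard_instance {n r T : ℕ} {a : Fin r → ℕ} {L x c : ℝ} (hL : 2 ≤ L) (hx : 100 ≤ x)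
    (hnLx : (n : ℝ) = L * x ^ 3) (hexp : (n : ℝ) ^ c * (n : ℝ) ^ 2 = Real.exp L)
    (hr_ge : x / 4 ≤ r) (hr_lt : (r : ℝ) < x / 4 + 1)
    (ha_le : ∀ i, (a i : ℝ) ≤ ((i : ℕ) + 1) * (12 * (L * x)))
    (ha_gt : ∀ i : Fin r, ((i : ℕ) + 1 : ℝ) * (12 * (L * x)) - 1 < a i) (hTr : T < r)
    (A : RandAlg.{u} n T) (hA : A.QueriesAtMost ((n : ℝ) ^ c)) :
    ∃ (b : Fin n → Fin r) (R : Fin r → ℕ),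
      (∀ i, #{y | b y = i} = n / r ∨ #{y | b y = i} = n / r + 1) ∧
      (∀ i, R i + a i = #{y | b y = i}) ∧
      ∀ κ : ℝ, ∃ ω : Ensemble n R, (∀ i, FullOn (ω.2.1 i) (blockOf b ω.1 i)) ∧
        A.outputProb (fun H => κ * #(sols (blockOf b ω.1) ω.2.1 ω.2.2 univ H))
          {x | ∀ i, mulOn (blockOf b ω.1 i) (ω.2.1 i) x = ω.2.2 i} ≤ 1 / 100 := by
  have hr0 : 0 < r := by omega
  have hLx : 200 ≤ L * x := by nlinarith
  obtain ⟨b, hb⟩ := exists_balanced n hr0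
  have hr0' : (0 : ℝ) < r := by exact_mod_cast hr0
  have hq_gt : (n : ℝ) / r - 1 < (n / r : ℕ) := by
    rw [← Nat.floor_div_eq_div (K := ℝ)]; exact Nat.sub_one_lt_floor _
  have hq_le : ((n / r : ℕ) : ℝ) ≤ 4 * (L * x ^ 2) := by
    refine Nat.cast_div_le.trans ?_
    rw [div_le_iff₀ hr0', hnLx]
    have : 0 ≤ 4 * (L * x ^ 2) := by positivity
    nlinarith
  have hdiv : 4 * (L * x ^ 2) - 16 * (L * x) ≤ (n : ℝ) / r := by
    rw [le_div_iff₀ hr0', hnLx]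
    have h1 : 0 ≤ 4 * (L * x ^ 2) - 16 * (L * x) := by nlinarith
    nlinarith [mul_le_mul_of_nonneg_left hr_lt.le h1]
  -- The largest dimension is at most `3 L x² + 12 L x`, while blocks have size about `4 L x²`. The
  -- slack 10 leaves at least 10 equations per block, enough for the final `2 ^ (-R last)`.
  have hbig : ∀ i, a i + 10 ≤ n / r := by
    intro i
    have hi : ((i : ℕ) : ℝ) + 1 ≤ r := by exact_mod_cast i.2
    have h1 : ((i : ℕ) + 1 : ℝ) * (12 * (L * x)) ≤ (x / 4 + 1) * (12 * (L * x)) := by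
      refine mul_le_mul_of_nonneg_right (by linarith) (by linarith)
    have h2 : ((a i + 10 : ℕ) : ℝ) ≤ ((n / r : ℕ) : ℝ) := by
      push_cast
      nlinarith [ha_le i]
    exact_mod_cast h2
  let R : Fin r → ℕ := fun i => #{y | b y = i} - a i
  have hR : ∀ i, R i + a i = #{y | b y = i} := fun i => by
    have := hbig i
    rcases hb i with h | h <;> simp only [R] <;> omega
  have hR10 : ∀ i, 10 ≤ R i := fun i => by
    have h1 := hbig i
    have h2 := hR i
    rcases hb i with h | h <;> omega
  -- One unit is lost to the rounding of `a j`, another to unequal block sizes.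
  have hRdiff : ∀ t j, t < j → 12 * (L * x) - 2 ≤ (R t : ℝ) - R j := by
    intro t j htj
    have h1 : a j + R j ≤ a t + R t + 1 := by
      have h2 := hR t
      have h3 := hR j
      rcases hb t with h | h <;> rcases hb j with h' | h' <;> omega
    have h2 : (a j : ℝ) + R j ≤ a t + R t + 1 := by exact_mod_cast h1
    have h3 : ((t : ℕ) : ℝ) + 1 ≤ (j : ℕ) := by exact_mod_cast htj
    have h4 : ((t : ℕ) + 1 : ℝ) * (12 * (L * x)) + 12 * (L * x) ≤
        ((j : ℕ) + 1 : ℝ) * (12 * (L * x)) := by nlinarith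
    linarith [ha_le t, ha_gt j]
  have hx0 : 0 < x := by linarith
  -- With `lam = 1 / x` the variance term costs at most `2 L` and the gap gains `12 L`; the
  -- remaining `3 / x` is below `L`.
  have hε : ∀ t j, t < j →
      Real.exp (1 / x + (n / r : ℕ) * ((1 / x) ^ 2 / 2) - 1 / x * (R t - R j)) ≤
        Real.exp (-(9 * L)) := by
    intro t j htj
    rw [Real.exp_le_exp]
    have h1 : ((n / r : ℕ) : ℝ) * ((1 / x) ^ 2 / 2) ≤ 4 * (L * x ^ 2) * ((1 / x) ^ 2 / 2) :=
      mul_le_mul_of_nonneg_right hq_le (by positivity)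
    have h2 : 4 * (L * x ^ 2) * ((1 / x) ^ 2 / 2) = 2 * L := by field_simp; norm_num
    have h3 : 1 / x * (12 * (L * x) - 2) ≤ 1 / x * ((R t : ℝ) - R j) :=
      mul_le_mul_of_nonneg_left (hRdiff t j htj) (by positivity)
    have h4 : 1 / x * (12 * (L * x) - 2) = 12 * L - 2 * (1 / x) := by field_simp
    have h5 : 1 / x ≤ 1 / 100 := one_div_le_one_div_of_le (by norm_num) hx
    linarith
  have hlam : 1 / x ≤ Real.log 2 / 2 := by
    have h5 : 1 / x ≤ 1 / 100 := one_div_le_one_div_of_le (by norm_num) hx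
    linarith [Real.log_two_gt_d9]
  have hd : ∀ i, r ≤ a i := fun i => by
    have h1 : ((0 : ℝ) + 1) * (12 * (L * x)) ≤ ((i : ℕ) + 1 : ℝ) * (12 * (L * x)) := by
      gcongr; simp
    have h2 : (r : ℝ) ≤ a i := by
      have h3 : x ≤ L * x := le_mul_of_one_le_left (by linarith) (by linarith)
      linarith [ha_gt i]
    exact_mod_cast h2
  have hd' : (r : ℝ) * (1 / 2) ^ r ≤ 1 / 2 := by
    obtain ⟨s, hs⟩ := Nat.exists_eq_succ_of_ne_zero hr0.ne'
    have h1 : r ≤ 2 ^ s := by rw [hs]; exact Nat.lt_two_pow_self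
    have h2 : (r : ℝ) ≤ 2 ^ s := by exact_mod_cast h1
    calc (r : ℝ) * (1 / 2) ^ r ≤ 2 ^ s * (1 / 2) ^ r := by gcongr
      _ = 1 / 2 := by
        rw [hs, Nat.succ_eq_add_one, pow_succ, ← mul_assoc, ← mul_pow]; norm_num
  have hrn : (r : ℝ) ≤ n := by
    rw [hnLx]
    have : x ≤ L * x ^ 3 := by
      calc x ≤ (L * x ^ 2) * x := le_mul_of_one_le_left hx0.le
            (one_le_mul_of_one_le_of_one_le (by linarith) (one_le_pow₀ (by linarith)))
        _ = L * x ^ 3 := by ring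
    linarith
  have hk : (0 : ℝ) ≤ (n : ℝ) ^ c := Real.rpow_nonneg (Nat.cast_nonneg n) c
  let last : Fin r := ⟨r - 1, by omega⟩
  -- Since `r ≤ n`, the union bound over pairs and queries costs at most `n ^ 2 * n ^ c = exp L`,
  -- leaving `exp (-8 L) ≤ exp (-16)`.
  have hfin : 2 * ((r : ℝ) * (r * (Real.exp (-(9 * L)) * (n : ℝ) ^ c)) + (1 / 2) ^ R last) ≤
      1 / 100 := by
    have h1 : (r : ℝ) * (r * (Real.exp (-(9 * L)) * (n : ℝ) ^ c)) ≤ (1 / 2) ^ 16 := by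
      calc (r : ℝ) * (r * (Real.exp (-(9 * L)) * (n : ℝ) ^ c))
          ≤ n * (n * (Real.exp (-(9 * L)) * (n : ℝ) ^ c)) := by gcongr
        _ = Real.exp (-(9 * L)) * ((n : ℝ) ^ c * (n : ℝ) ^ 2) := by ring
        _ = Real.exp (-(8 * L)) := by rw [hexp, ← Real.exp_add]; congr 1; ring
        _ ≤ Real.exp (-16) := Real.exp_le_exp.2 (by linarith)
        _ = Real.exp (-1) ^ 16 := by rw [← Real.exp_nat_mul]; norm_num
        _ ≤ (1 / 2) ^ 16 := by
          refine pow_le_pow_left₀ (Real.exp_pos _).le ?_ 16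
          rw [Real.exp_neg, one_div]
          exact inv_anti₀ two_pos (by linarith [Real.add_one_le_exp (1 : ℝ)])
    have h2 : (1 / 2 : ℝ) ^ R last ≤ (1 / 2) ^ 10 :=
      pow_le_pow_of_le_one (by norm_num) (by norm_num) (hR10 last)
    norm_num at h1 h2 ⊢
    linarith
  refine ⟨b, R, hb, hR, fun κ => ?_⟩
  obtain ⟨ω, hω, hp⟩ := A.exists_outputProb_le hb hR hk hA κ (by positivity) hlam
    (Real.exp_pos _).le hε (i := last) (show T ≤ r - 1 by omega) hd hd'
  exact ⟨ω, hω, hp.trans hfin⟩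

theorem theorem5p1 (δ : ℝ) (hδ0 : 0 < δ) (hδ1 : δ ≤ 1) :
    ∃ n₀ : ℕ, ∀ n : ℕ, n₀ ≤ n → ∀ c : ℝ, 0 < c → c < (n : ℝ) ^ (1 - δ) →
      ∀ T : ℕ, (T : ℝ) < roundBound n c →
      ∀ A : RandAlg.{u} n T, A.QueriesAtMost ((n : ℝ) ^ c) →
        -- search: some instance, a nonempty affine subspace, whose points `A` hardly ever finds
        (∃ I : BlockCode n (numBlocks n c) (codeDim n c),
          (∃ V : AffineSubspace (ZMod 2) (Cube n), (V : Set (Cube n)) = I.support ∧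
            (V : Set (Cube n)).Nonempty) ∧
          A.outputProb (countingOracle I.mu) I.support ≤ 1 / 100) ∧
        -- sampling: some uniform distribution on such an instance that `A` does not approximate
        (∃ I : BlockCode n (numBlocks n c) (codeDim n c),
          (∃ V : AffineSubspace (ZMod 2) (Cube n), (V : Set (Cube n)) = I.support ∧
            (V : Set (Cube n)).Nonempty) ∧
          99 / 100 ≤
            tvDist (fun x => A.outputProb (countingOracle I.uniform) {x}) I.uniform) := by
  obtain ⟨n₀, h₀⟩ := exists_params hδ0 hδ1
  refine ⟨n₀, fun n hn c hc0 hc T hT A hA => ?_⟩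
  obtain ⟨L, x, hL, hx, hnLx, hρ, hw, hexp⟩ := h₀ n hn c hc0 hc
  have hr_ge : x / 4 ≤ numBlocks n c := by rw [numBlocks, ← hρ]; exact Nat.le_ceil _
  have hr_lt : (numBlocks n c : ℝ) < x / 4 + 1 := by
    rw [numBlocks, hρ]; exact Nat.ceil_lt_add_one (by linarith)
  have hTr : T < numBlocks n c := by
    have : (T : ℝ) < numBlocks n c := by rw [hρ] at hT; linarith
    exact_mod_cast this
  have hLx : 0 ≤ 12 * (L * x) := by positivity
  obtain ⟨b, R, hb, hR, key⟩ := exists_hard_instance (a := codeDim n c) hL hx hnLx hexp hr_ge hr_lt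
    (fun i => by rw [codeDim, hw]; exact Nat.floor_le (by positivity))
    (fun i => by rw [codeDim, hw]; exact Nat.sub_one_lt_floor _) hTr A hA
  constructor
  · obtain ⟨ω, hω, hp⟩ := key 1
    have hsupp : (ω.toBlockCode hb hR hω).support =
        {x | ∀ i, mulOn (blockOf b ω.1 i) (ω.2.1 i) x = ω.2.2 i} :=
      Set.ext fun x => ω.mem_support_toBlockCode hb hR hω
    refine ⟨ω.toBlockCode hb hR hω, ⟨(ω.toBlockCode hb hR hω).affineSupport, rfl,
      ω.nonempty_support hb hR hω⟩, ?_⟩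
    rw [hsupp, ω.countingOracle_mu hb hR hω]
    simp only [one_mul] at hp
    exact hp
  · obtain ⟨ω, hω, hp⟩ := key (2 ^ n / 2 ^ ∑ i, R i : ℝ)⁻¹
    have hsupp : (ω.toBlockCode hb hR hω).support =
        {x | ∀ i, mulOn (blockOf b ω.1 i) (ω.2.1 i) x = ω.2.2 i} :=
      Set.ext fun x => ω.mem_support_toBlockCode hb hR hω
    refine ⟨ω.toBlockCode hb hR hω, ⟨(ω.toBlockCode hb hR hω).affineSupport, rfl,
      ω.nonempty_support hb hR hω⟩, ?_⟩
    refine le_trans ?_ (A.one_sub_outputProb_le_tvDist _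
      (by rw [ω.sum_mu hb hR hω]; positivity) _)
    rw [hsupp, ω.countingOracle_uniform hb hR hω]
    linarith
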